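/- Let $\nu$ be a probability measure on $\mathbb R$ with $\nu(\{0\})=0$, and let $\Omega$ be the space of locally finite simple counting measures $\omega$ on $\mathbb R_+\times\mathbb R_+\times\mathbb R$ (finitely many atoms $(u,\theta,y)$ in each $[0,T]\times[0,b]\times\mathbb R$), with the $\sigma$-field generated by the maps $\omega\mapsto\omega(B)$. Let $\mathbb P$ be the probability on $\Omega$ under which $N(\omega)=\omega$ is a Poisson random measure with intensity $dt\otimes d\theta\otimes\nu$, and let $\mathcal F^N_t=\sigma(N(\mathcal T\times B):\mathcal T\subset[0,t])$. For $z=(t,\theta,x)$ put $(\varepsilon_z^+\omega)(A)=\omega(A\setminus\{z\})+\mathbf 1_A(z)$ and, for $F:\Omega\to\mathbb R$, $D_{(t,\theta,x)}F=F\circ\varepsilon^+_{(t,\theta,x)}-F$. Let $\mu>0$ and let $\Phi:\mathbb R_+\to\mathbb R_+$ be measurable and bounded with $\int_0^\infty\Phi(u)\,du<1$. Let $(X,H,\lambda)$ be the solution, $\omega$ by $\omega$, of $$X_s=\int_{(0,s]\times\mathbb R_+\times\mathbb R}y\,\mathbf 1_{\{\theta\le\lambda_u\}}N(du,d\theta,dy),\quad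 H_s=\int_{(0,s]\times\mathbb R_+\times\mathbb R}\mathbf 1_{\{\theta\le\lambda_u\}}N(du,d\theta,dy),\quad \lambda_s=\mu+\int_{(0,s)}\Phi(s-u)\,dH_u,\qquad s\ge0,$$ where a solution has finitely many atoms with $\theta\le\lambda_u$ in each bounded time interval (and where $(X,H,\lambda)(\omega):=0$ if there is no solution on $[0,\infty)$ at $\omega$). Write $D_{(t,\lambda_t,x)}F:=\mathbf 1_{\{\theta\le\lambda_t\}}D_{(t,\theta,x)}F$, for $\theta\ge0$. Then $\mathbb P$-a.s. $(X,H,\lambda)$ exists and is unique, and for every $t\ge0$ the following holds. (1) There is a triple $(\hat X^t,\hat H^t,\hat\lambda^t)$, with $\hat X^t,\hat H^t$ $\mathbb F^N$-adapted and $\hat\lambda^t$ $\mathbb F^N$-predictable on $[t,\infty)$, which $\mathbb P$-a.s. is the unique solution (pathwise, among paths selecting finitely many atoms in bounded time intervals) of $$\hat H^t_s=\int_{(t,s]\times\mathbb R_+\times\mathbb R}\mathbf 1_{\{\lambda_u\le\theta\le\lambda_u+\hat\lambda^t_u\}}N(du,d\theta,dy),\qquad \hat X^t_s=\int_{(t,s]\times\mathbb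 R_+\times\mathbb R}y\,\mathbf 1_{\{\lambda_u\le\theta\le\lambda_u+\hat\lambda^t_u\}}N(du,d\theta,dy),\qquad s\ge t,$$ $$\hat\lambda^t_s=\Phi(s-t)+\int_{(t,s)}\Phi(s-u)\,d\hat H^t_u,\quad s>t,\qquad \hat\lambda^t_t=0.$$ (2) If $t>0$, then $\mathbb P$-a.s., for all $x\in\mathbb R$, all $\theta\in[0,\lambda_t]$ and all $s\ge0$, $$\bigl(D_{(t,\lambda_t,x)}X_s,\;D_{(t,\lambda_t,x)}H_s,\;D_{(t,\lambda_t,x)}\lambda_s\bigr)=\begin{cases}(x+\hat X^t_s,\;1+\hat H^t_s,\;\hat\lambda^t_s),& s\ge t,\\(0,0,0),&s<t.\end{cases}$$ (3) $(\hat H^t,\hat\lambda^t)$ is a generalized Hawkes process on $[t,\infty)$ with kernel $\Phi$, initial value $0$ and initial intensity $\mu^t(s)=\mathbf 1_{\{s>t\}}\Phi(s-t)$. That is, $\hat H^t$ is an $\mathbb F^N$-adapted counting process with $\hat H^t_t=0$ a.s., $\hat\lambda^t$ is $\mathbb F^N$-predictable, a.s. $\hat\lambda^t_s=\mu^t(s)+\int_{(t,s)}\Phi(s-u)\,d\hat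 H^t_u$ for all $s\ge t$, and for all $t\le s\le r$ and $A\in\mathcal F^N_s$ the variables $\hat H^t_r-\hat H^t_s$ and $\int_{(s,r]}\hat\lambda^t_u\,du$ are integrable and $$\mathbb E\bigl[\mathbf 1_A(\hat H^t_r-\hat H^t_s)\,\big|\,\mathcal F^N_t\bigr]=\mathbb E\Bigl[\int_{(s,r]}\mathbf 1_A\hat\lambda^t_u\,du\,\Big|\,\mathcal F^N_t\Bigr]\quad\text{a.s.}$$ The initial intensity is not bounded away from $0$: $\inf_{s>t}\mu^t(s)=0$. -/

import Mathlib

open MeasureTheory ProbabilityTheory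
open scoped NNReal ENNReal

noncomputable section

namespace HawkesMalliavin

/-! ### The Poisson space -/

/-- Atoms `(t, θ, x)`: time, auxiliary thinning variable, jump size. -/
abbrev Mark : Type := ℝ≥0 × ℝ≥0 × ℝ

/-- Lebesgue measure on `[0, ∞)`. -/
def lebesgue : Measure ℝ≥0 := Measure.comap ((↑) : ℝ≥0 → ℝ) (volume : Measure ℝ)

/-- The intensity measure `dt ⊗ dθ ⊗ ν`. -/
def intensityMeasure (ν : Measure ℝ) : Measure Mark := lebesgue.prod (lebesgue.prod ν)

/-- The counting measure `∑_{z ∈ S} δ_z`. -/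
def pointMeasure (S : Set Mark) : Measure Mark := Measure.sum fun z : S => Measure.dirac (z : Mark)

/-- `S` has finitely many points in each slab `[0, T] × [0, b] × ℝ`. -/
def IsLocallyFinite (S : Set Mark) : Prop :=
  ∀ T b : ℝ≥0, (S ∩ {z | z.1 ≤ T ∧ z.2.1 ≤ b}).Finite

/-- The space of configurations: locally finite simple counting measures. As a subtype of
`Measure Mark` it carries the σ-algebra generated by the evaluations `ω ↦ ω B`. -/
abbrev Config : Type := {ω : Measure Mark // ∃ S, IsLocallyFinite S ∧ ω = pointMeasure S}

theorem pointMeasure_apply (S : Set Mark) {A : Set Mark} (hA : MeasurableSet A) :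
    pointMeasure S A = ∑' z, (S ∩ A).indicator (fun _ => (1 : ℝ≥0∞)) z := by
  rw [pointMeasure, Measure.sum_apply _ hA]
  simp_rw [Measure.dirac_apply' _ hA]
  rw [tsum_subtype S (fun z => A.indicator (1 : Mark → ℝ≥0∞) z)]
  congr 1
  ext z
  by_cases h1 : z ∈ S <;> by_cases h2 : z ∈ A <;> simp [h1, h2]

theorem pointMeasure_shift (S : Set Mark) (z : Mark) :
    (pointMeasure S).restrict {z}ᶜ + Measure.dirac z = pointMeasure (insert z S) := by
  ext A hA
  rw [Measure.add_apply, Measure.restrict_apply hA, pointMeasure_apply _ hA,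
    pointMeasure_apply _ (hA.inter (measurableSet_singleton z).compl),
    Measure.dirac_apply' _ hA]
  have h : A.indicator (1 : Mark → ℝ≥0∞) z
      = ∑' w, ({z} ∩ A).indicator (fun _ => (1 : ℝ≥0∞)) w := by
    rw [tsum_eq_single z]
    · by_cases hz : z ∈ A <;> simp [hz]
    · intro w hw
      simp [hw]
  rw [h, ← ENNReal.tsum_add]
  congr 1
  ext w
  by_cases h1 : w = z
  · subst h1
    by_cases h2 : w ∈ A <;> simp [h2]
  · by_cases h2 : w ∈ A <;> by_cases h3 : w ∈ S <;> simp [h1, h2, h3]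

/-- The shift `ε⁺_z`: `ε⁺_z(ω)(A) = ω(A \ {z}) + 1_A(z)`. -/
def shift (z : Mark) (ω : Config) : Config :=
  ⟨ω.1.restrict {z}ᶜ + Measure.dirac z, by
    obtain ⟨S, hS, hω⟩ := ω.2
    refine ⟨insert z S, fun T b => ?_, by rw [hω, pointMeasure_shift]⟩
    exact ((hS T b).insert z).subset fun w hw => by
      rcases hw.1 with h | h
      · exact Or.inl h
      · exact Or.inr ⟨h, hw.2⟩⟩

/-- Under `P` the canonical random measure `N(ω) = ω` is a Poisson random measure with intensity
`I`. -/
structure IsPoissonRandomMeasure (P : Measure Config) (I : Measure Mark) : Prop where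
  law : ∀ B, MeasurableSet B → I B < ∞ → ∀ n : ℕ,
    P {ω | ω.1 B = n} = poissonMeasure (I B).toNNReal {n}
  indep : ∀ (k : ℕ) (B : Fin k → Set Mark), (∀ i, MeasurableSet (B i)) →
    Pairwise (Function.onFun Disjoint B) → iIndepFun (fun i (ω : Config) => ω.1 (B i)) P

/-- The natural history `F^N` of the canonical random measure:
`F_t^N = σ(N(T × B) : T ⊆ [0, t])`. -/
def history : Filtration ℝ≥0 (inferInstance : MeasurableSpace Config) where
  seq t := ⨆ (T : Set ℝ≥0) (_ : MeasurableSet T ∧ T ⊆ Set.Iic t)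
    (B : Set (ℝ≥0 × ℝ)) (_ : MeasurableSet B),
      MeasurableSpace.comap (fun ω : Config => ω.1 (T ×ˢ B)) inferInstance
  mono' s t hst := by
    refine iSup_le fun T => iSup_le fun hT => ?_
    exact le_iSup_of_le T (le_iSup_of_le ⟨hT.1, hT.2.trans (Set.Iic_subset_Iic.2 hst)⟩ le_rfl)
  le' t := by
    refine iSup_le fun T => iSup_le fun hT => iSup_le fun B => iSup_le fun hB => ?_
    exact Measurable.comap_le
      ((Measure.measurable_coe (hT.1.prod hB)).comp measurable_subtype_coe)

/-- The Malliavin derivative `D_z F = F ∘ ε⁺_z - F`. -/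
def malliavinDeriv (z : Mark) (F : Config → ℝ) (ω : Config) : ℝ := F (shift z ω) - F ω

/-! ### The compound Hawkes process -/

/-- `Φ` is a bounded kernel with `‖Φ‖₁ < 1`. -/
structure IsHawkesKernel (Φ : ℝ≥0 → ℝ≥0) : Prop where
  measurable : Measurable Φ
  bounded : ∃ C, ∀ u, Φ u ≤ C
  norm_lt_one : ∫⁻ u, (Φ u : ℝ≥0∞) ∂lebesgue < 1

/-- The pathwise Stieltjes integral `∫_{(a,b)} f(u) dh(u)` against a path `h` that, like those of
a counting process, is piecewise constant with finitely many jumps in `(a,b)`: it is the sum of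
`f(u) (h(u) - h(u-))` over the jump times `u`. -/
def jumpIntegral (f h : ℝ≥0 → ℝ) (a b : ℝ≥0) : ℝ :=
  ∑ᶠ u ∈ Set.Ioo a b, f u * (h u - Function.leftLim h u)

open Classical in
/-- The paths `(X, H, lam)` solve the thinning equation of the compound Hawkes process with
baseline `μ` and kernel `Φ`, driven by the configuration `ω`. -/
structure SolvesHawkes (μ : ℝ) (Φ : ℝ≥0 → ℝ≥0) (ω : Config) (X H lam : ℝ≥0 → ℝ) : Prop where
  finite : ∀ t, ω.1 {z | z.1 ∈ Set.Ioc 0 t ∧ (z.2.1 : ℝ) ≤ lam z.1} < ∞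
  X_eq : ∀ t, X t = ∫ z in Set.Ioc 0 t ×ˢ Set.univ,
    (if (z.2.1 : ℝ) ≤ lam z.1 then z.2.2 else 0) ∂ω.1
  H_eq : ∀ t, H t = ∫ z in Set.Ioc 0 t ×ˢ Set.univ,
    (if (z.2.1 : ℝ) ≤ lam z.1 then (1 : ℝ) else 0) ∂ω.1
  lam_eq : ∀ t, lam t = μ + jumpIntegral (fun u => (Φ (t - u) : ℝ)) H 0 t

open Classical in
/-- The solution `(X, H, λ)` of the thinning equation, as a functional of the configuration. It
is set to zero at the configurations at which there is no solution on the whole of `[0, ∞)`. -/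
def hawkesSolution (μ : ℝ) (Φ : ℝ≥0 → ℝ≥0) (ω : Config) :
    (ℝ≥0 → ℝ) × (ℝ≥0 → ℝ) × (ℝ≥0 → ℝ) :=
  if h : ∃ p : (ℝ≥0 → ℝ) × (ℝ≥0 → ℝ) × (ℝ≥0 → ℝ), SolvesHawkes μ Φ ω p.1 p.2.1 p.2.2
  then h.choose else 0

/-- The compound Hawkes process `X`. -/
def compound (μ : ℝ) (Φ : ℝ≥0 → ℝ≥0) (s : ℝ≥0) (ω : Config) : ℝ := (hawkesSolution μ Φ ω).1 s

/-- The Hawkes process `H`. -/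
def hawkes (μ : ℝ) (Φ : ℝ≥0 → ℝ≥0) (s : ℝ≥0) (ω : Config) : ℝ := (hawkesSolution μ Φ ω).2.1 s

/-- The intensity process `λ`. -/
def intensity (μ : ℝ) (Φ : ℝ≥0 → ℝ≥0) (s : ℝ≥0) (ω : Config) : ℝ := (hawkesSolution μ Φ ω).2.2 s

open Classical in
/-- `D_{(t,λ_t,x)} F = 1_{θ ≤ λ_t} D_{(t,θ,x)} F`, with the parameter `θ` written out. -/
def hawkesDeriv (μ : ℝ) (Φ : ℝ≥0 → ℝ≥0) (t θ : ℝ≥0) (x : ℝ) (F : Config → ℝ) (ω : Config) : ℝ :=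
  if (θ : ℝ) ≤ intensity μ Φ t ω then malliavinDeriv (t, θ, x) F ω else 0

open Classical in
/-- The paths `(X, H, hlam)`, considered on `[t, ∞)`, solve at the configuration `ω` the thinning
equation started at time `t` with initial intensity `Φ(· - t)`, in which the atoms are kept that
lie in the region `λ_u ≤ θ ≤ λ_u + hlam_u`, where `λ` is the path `lam`. -/
structure SolvesShifted (Φ : ℝ≥0 → ℝ≥0) (lam : ℝ≥0 → ℝ) (t : ℝ≥0) (ω : Config)
    (X H hlam : ℝ≥0 → ℝ) : Prop where
  finite : ∀ s, t ≤ s → ω.1 {z | z.1 ∈ Set.Ioc t s ∧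
    lam z.1 ≤ (z.2.1 : ℝ) ∧ (z.2.1 : ℝ) ≤ lam z.1 + hlam z.1} < ∞
  H_eq : ∀ s, t ≤ s → H s = ∫ z in Set.Ioc t s ×ˢ Set.univ,
    (if lam z.1 ≤ (z.2.1 : ℝ) ∧ (z.2.1 : ℝ) ≤ lam z.1 + hlam z.1 then (1 : ℝ) else 0) ∂ω.1
  X_eq : ∀ s, t ≤ s → X s = ∫ z in Set.Ioc t s ×ˢ Set.univ,
    (if lam z.1 ≤ (z.2.1 : ℝ) ∧ (z.2.1 : ℝ) ≤ lam z.1 + hlam z.1 then z.2.2 else 0) ∂ω.1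
  lam_eq : ∀ s, t < s → hlam s = Φ (s - t) + jumpIntegral (fun u => (Φ (s - u) : ℝ)) H t s
  lam_init : hlam t = 0

/-! ### Generalized Hawkes processes -/

/-- `h` is on `[v, ∞)` a path of a counting process: `ℕ`-valued, nondecreasing, right-continuous,
with jumps of size one. -/
structure IsCountingPath (v : ℝ≥0) (h : ℝ≥0 → ℝ) : Prop where
  nat : ∀ s, v ≤ s → ∃ n : ℕ, h s = n
  mono : MonotoneOn h (Set.Ici v)
  rightCont : ∀ s, v ≤ s → ContinuousWithinAt h (Set.Ici s) s
  unitJump : ∀ s, v < s → h s - Function.leftLim h s ≤ 1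

open Classical in
/-- `(H, lam)` is a Hawkes process on `[v, ∞)` with initial intensity `m`, initial value `h` and
kernel `Φ`, relative to the filtration `F^N`. The initial intensity is allowed to vanish. -/
structure IsGeneralizedHawkes (P : Measure Config) (v : ℝ≥0) (m : ℝ≥0 → Config → ℝ)
    (h : Config → ℕ) (Φ : ℝ≥0 → ℝ≥0) (H lam : ℝ≥0 → Config → ℝ) : Prop where
  kernel : IsHawkesKernel Φ
  init_meas : Measurable[history v] h
  base_meas : ∀ s, v ≤ s → Measurable[history v] (m s)
  base_nonneg : ∀ s, v ≤ s → ∀ ω, 0 ≤ m s ω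
  adapted : ∀ s, v ≤ s → Measurable[history s] (H s)
  counting : ∀ᵐ ω ∂P, IsCountingPath v fun s => H s ω
  init : ∀ᵐ ω ∂P, H v ω = h ω
  intensity_eq : ∀ᵐ ω ∂P, ∀ s, v ≤ s →
    lam s ω = m s ω + jumpIntegral (fun u => (Φ (s - u) : ℝ)) (fun u => H u ω) v s
  /- Predictability on `[v, ∞)`. -/
  predictable_init : Measurable[history v] (lam v)
  predictable : IsStronglyPredictable history fun s ω => if v < s then lam s ω else 0
  /- `lam` is the intensity of `H`. -/
  integrable_H : ∀ s u, v ≤ s → s ≤ u → Integrable (fun ω => H u ω - H s ω) P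
  integrable_lam : ∀ s u, v ≤ s → s ≤ u →
    Integrable (fun ω => ∫ r in Set.Ioc s u, lam r ω ∂lebesgue) P
  compensator : ∀ s u, v ≤ s → s ≤ u → ∀ A : Set Config, MeasurableSet[history s] A →
    P[fun ω => A.indicator 1 ω * (H u ω - H s ω) | history v]
      =ᵐ[P] P[fun ω => ∫ r in Set.Ioc s u, A.indicator 1 ω * lam r ω ∂lebesgue | history v]

open Classical in
/-- The deterministic initial intensity `s ↦ 1_{s > t} Φ(s - t)`. -/
def shiftedBase (Φ : ℝ≥0 → ℝ≥0) (t s : ℝ≥0) : ℝ := if t < s then (Φ (s - t) : ℝ) else 0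

end HawkesMalliavin

end

/-!
The compound Hawkes equation and the shifted equation are instances of one thinning equation: the
atoms `(u, θ, y)` after time `v` with `L_u ≤ θ ≤ L_u + ℓ_u` are kept, and `ℓ` is a base intensity
plus the sum of `Φ (s - u)` over the atoms kept before `s`. The first has `L = 0` and `v = 0`, the
second has `L = λ`, `v = t` and the base intensity `1_{s > t} Φ (s - t)`. The theorem is a statement
about this equation (`SolvesThinning`), in which all integrals are finite sums over atoms
(`solvesHawkes_iff`, `solvesShifted_iff`).

*Uniqueness* is pathwise (`SolvesThinning.unique`): an intensity at time `s` depends only on the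
atoms kept before `s`, so two solutions cannot differ at a first atom, and there is a first one
because both solutions keep finitely many atoms in bounded time.

*Existence* is by Picard iteration from `0`, carried out for intensities with values in `[0, ∞]`, so
that the monotone limit `picardLimit` is defined at every configuration and is predictable
everywhere, by construction. The iteration uses the half-open region `L ≤ θ < L + ℓ`; its
membership condition passes to increasing limits, hence the limit is a fixed point
(`picardLimit_eq`). Almost surely no atom lies on the graph of a predictable process
(`IsPoissonRandomMeasure.ae_ne_predictable`), so that the half-open and the closed region keep the
same atoms. For finiteness, a Picard step adds the integral `M` of the base intensity over the time
interval to the mean integrated intensity, and multiplies that of the previous iterate by at most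
`ρ = ∫ Φ < 1`; all iterates are therefore bounded by `M / (1 - ρ)`
(`IsPoissonRandomMeasure.meanIntensity_picardLimit_lt_top`).

Both the mean bound and the martingale property of the generalized Hawkes process come from the
compensation formula for predictable integrands (`IsPoissonRandomMeasure.lintegral_lintegral`):
the Poisson random measure and its intensity give them the same mean. On predictable rectangles
`(a, ∞) × A` it says that a count after time `a` is independent of the past up to `a`
(`IsPoissonRandomMeasure.indep_history`), and a π-λ argument does the rest.

*The Malliavin derivative.* Adding an atom `(t, θ, x)` with `θ ≤ λ_t` leaves `λ` unchanged up to
time `t`. If `(hX, hH, hlam)` solves the shifted equation, then the intensity that is `λ` before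
time `t` and `λ + hlam` afterwards keeps exactly the new atom, the atoms below `λ`, and those
between `λ` and `λ + hlam`. Hence the sums solve the Hawkes equation of the enlarged configuration
(`SolvesThinning.shift`), and by uniqueness they are its solution. The exceptional null set does not
depend on `θ` or `x`: apart from the configurations at which one of the two equations has no
solution, it only has to contain those with an atom at time `t` or on the graph of `λ`.
-/

noncomputable section

namespace HawkesMalliavin

/-! ### Configurations as sets of atoms -/

/-- The set of atoms of a configuration. -/
def atoms (ω : Config) : Set Mark := {z | ω.1 {z} ≠ 0}

theorem IsLocallyFinite.countable {S : Set Mark} (hS : IsLocallyFinite S) : S.Countable := by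
  have h : S ⊆ ⋃ n : ℕ, S ∩ {z | z.1 ≤ (n : ℝ≥0) ∧ z.2.1 ≤ (n : ℝ≥0)} := by
    intro z hz
    obtain ⟨n, hn⟩ := exists_nat_ge (max z.1 z.2.1)
    exact Set.mem_iUnion.2 ⟨n, hz, (le_max_left z.1 z.2.1).trans hn,
      (le_max_right z.1 z.2.1).trans hn⟩
  exact (Set.countable_iUnion fun n : ℕ => (hS n n).countable).mono h

theorem pointMeasure_singleton (S : Set Mark) (z : Mark) :
    pointMeasure S {z} = S.indicator (fun _ => (1 : ℝ≥0∞)) z := by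
  rw [pointMeasure_apply S (measurableSet_singleton z), tsum_eq_single z]
  · by_cases h : z ∈ S <;> simp [h]
  · intro w hw
    simp [hw]

theorem atoms_eq {ω : Config} {S : Set Mark} (h : ω.1 = pointMeasure S) : atoms ω = S := by
  ext z
  by_cases hz : z ∈ S <;> simp [atoms, h, pointMeasure_singleton, hz]

theorem isLocallyFinite_atoms (ω : Config) : IsLocallyFinite (atoms ω) := by
  obtain ⟨S, hS, hω⟩ := ω.2
  rwa [atoms_eq hω]

theorem val_eq_pointMeasure (ω : Config) : ω.1 = pointMeasure (atoms ω) := by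
  obtain ⟨S, hS, hω⟩ := ω.2
  rw [atoms_eq hω, hω]

theorem countable_atoms (ω : Config) : (atoms ω).Countable := (isLocallyFinite_atoms ω).countable

theorem atoms_shift (z : Mark) (ω : Config) : atoms (shift z ω) = insert z (atoms ω) := by
  apply atoms_eq
  rw [← pointMeasure_shift, ← val_eq_pointMeasure]
  rfl

theorem config_singleton {ω : Config} {z : Mark} (hz : z ∈ atoms ω) : ω.1 {z} = 1 := by
  rw [val_eq_pointMeasure, pointMeasure_singleton, Set.indicator_of_mem hz]

theorem config_apply_eq_encard (ω : Config) (D : Set Mark) :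
    ω.1 D = ((atoms ω ∩ D).encard : ℝ≥0∞) := by
  have : Countable (atoms ω) := (countable_atoms ω).to_subtype
  conv_lhs => rw [val_eq_pointMeasure]
  rw [pointMeasure, Measure.sum_apply_of_countable]
  simp_rw [Measure.dirac_apply]
  rw [tsum_subtype (atoms ω) (fun z => D.indicator (1 : Mark → ℝ≥0∞) z),
    Set.indicator_indicator, ← tsum_subtype (atoms ω ∩ D) (1 : Mark → ℝ≥0∞)]
  simp

theorem config_apply_lt_top_iff (ω : Config) (D : Set Mark) :
    ω.1 D < ∞ ↔ (atoms ω ∩ D).Finite := by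
  rw [config_apply_eq_encard]
  simp

theorem ae_config_iff (ω : Config) (p : Mark → Prop) :
    (∀ᵐ z ∂ω.1, p z) ↔ ∀ z ∈ atoms ω, p z := by
  rw [ae_iff, config_apply_eq_encard]
  simp only [ENat.toENNReal_eq_zero, Set.encard_eq_zero, Set.eq_empty_iff_forall_notMem]
  constructor
  · intro h z hz
    by_contra hp
    exact h z ⟨hz, hp⟩
  · rintro h z ⟨hz, hp⟩
    exact hp (h z hz)

theorem config_integral {ω : Config} {D : Set Mark} (f : Mark → ℝ) (hD : D.Finite)
    (hDω : D ⊆ atoms ω) (hf : ∀ z ∈ atoms ω, z ∉ D → f z = 0) :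
    ∫ z, f z ∂ω.1 = ∑ᶠ z ∈ D, f z := by
  lift D to Finset Mark using hD
  have h1 : ∀ᵐ z ∂ω.1, z ∉ (D : Set Mark) → f z = 0 := (ae_config_iff ω _).2 hf
  have hfin : ω.1 (D : Set Mark) < ∞ :=
    (config_apply_lt_top_iff ω _).2 (D.finite_toSet.subset Set.inter_subset_right)
  rw [← setIntegral_eq_integral_of_ae_compl_eq_zero h1, setIntegral_finset, finsum_mem_coe_finset]
  · refine Finset.sum_congr rfl fun z hz => ?_
    simp [measureReal_def, config_singleton (hDω hz)]
  · have : IsFiniteMeasure (ω.1.restrict (D : Set Mark)) := isFiniteMeasure_restrict.2 hfin.ne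
    have h := IntegrableOn.finset (μ := ω.1.restrict (D : Set Mark)) (s := D) (f := f)
    rwa [IntegrableOn, Measure.restrict_restrict D.measurableSet, Set.inter_self] at h

theorem config_lintegral {ω : Config} {D : Set Mark} (f : Mark → ℝ≥0) (hD : D.Finite)
    (hDω : D ⊆ atoms ω) (hf : ∀ z ∈ atoms ω, z ∉ D → f z = 0) :
    ∫⁻ z, f z ∂ω.1 = ENNReal.ofReal (∑ᶠ z ∈ D, (f z : ℝ)) := by
  lift D to Finset Mark using hD
  have h1 : ∀ᵐ z ∂ω.1, (f z : ℝ≥0∞) = (D : Set Mark).indicator (fun z => (f z : ℝ≥0∞)) z := by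
    refine (ae_config_iff ω _).2 fun z hz => ?_
    by_cases h : z ∈ (D : Set Mark)
    · simp only [h, Set.indicator_of_mem]
    · simp [h, hf z hz h]
  rw [lintegral_congr_ae h1, lintegral_indicator D.measurableSet, lintegral_finset,
    finsum_mem_coe_finset, ENNReal.ofReal_sum_of_nonneg fun _ _ => NNReal.coe_nonneg _]
  refine Finset.sum_congr rfl fun z hz => ?_
  rw [config_singleton (hDω hz), mul_one, ENNReal.ofReal_coe_nnreal]

/-! ### Thinning equations -/

/-- The atoms `(u, θ, y)` of `ω` after time `v` that lie in the region `L_u ≤ θ ≤ L_u + ℓ_u`. -/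
def kept (v : ℝ≥0) (L ℓ : ℝ≥0 → ℝ) (ω : Config) : Set Mark :=
  {z | z ∈ atoms ω ∧ v < z.1 ∧ L z.1 ≤ z.2.1 ∧ (z.2.1 : ℝ) ≤ L z.1 + ℓ z.1}

/-- The thinning equation on `[v, ∞)` with base intensity `m` and kernel `Φ` in the region above
the path `L`, with all integrals written as sums over the kept atoms. Both the compound Hawkes
equation (`L = 0`, `v = 0`) and the shifted equation are of this form. -/
structure SolvesThinning (m : ℝ≥0 → ℝ) (Φ : ℝ≥0 → ℝ≥0) (L : ℝ≥0 → ℝ) (v : ℝ≥0) (ω : Config)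
    (X H ℓ : ℝ≥0 → ℝ) : Prop where
  finite : ∀ s, (kept v L ℓ ω ∩ {z | z.1 ≤ s}).Finite
  H_eq : ∀ s, v ≤ s → H s = ∑ᶠ z ∈ kept v L ℓ ω ∩ {z | z.1 ≤ s}, (1 : ℝ)
  X_eq : ∀ s, v ≤ s → X s = ∑ᶠ z ∈ kept v L ℓ ω ∩ {z | z.1 ≤ s}, z.2.2
  lam_eq : ∀ s, v ≤ s →
    ℓ s = m s + ∑ᶠ z ∈ kept v L ℓ ω ∩ {z | z.1 < s}, (Φ (s - z.1) : ℝ)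

section JumpIntegral

variable {v : ℝ≥0} {A : Set Mark} {h : ℝ≥0 → ℝ}

theorem finsum_one_eq_ncard {B : Set Mark} (hB : B.Finite) : ∑ᶠ _z ∈ B, (1 : ℝ) = B.ncard := by
  rw [finsum_mem_eq_finite_toFinset_sum _ hB, Finset.sum_const, Set.ncard_eq_toFinset_card B hB,
    nsmul_eq_mul, mul_one]

/-- Just before time `u` the counting path has counted the points before `u`. -/
theorem eventually_left_inter_eq (hA : ∀ s, (A ∩ {z | z.1 ≤ s}).Finite) (u : ℝ≥0) :
    ∀ᶠ w in nhdsWithin u (Set.Iio u), A ∩ {z | z.1 ≤ w} = A ∩ {z | z.1 < u} := by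
  have hfin : (A ∩ {z | z.1 < u}).Finite :=
    (hA u).subset (Set.inter_subset_inter_right _ fun z (hz : z.1 < u) => hz.le)
  have h1 : ∀ᶠ w in nhdsWithin u (Set.Iio u), ∀ z ∈ A ∩ {z | z.1 < u}, z.1 < w := by
    rw [Filter.eventually_all_finite hfin]
    exact fun z hz => nhdsWithin_le_nhds (Ioi_mem_nhds hz.2)
  filter_upwards [h1, self_mem_nhdsWithin] with w hw hwu
  ext z
  exact ⟨fun hz => ⟨hz.1, lt_of_le_of_lt (show z.1 ≤ w from hz.2) hwu⟩,
    fun hz => ⟨hz.1, (hw z hz).le⟩⟩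

theorem jump_eq (hA : ∀ s, (A ∩ {z | z.1 ≤ s}).Finite)
    (hh : ∀ s, v ≤ s → h s = (A ∩ {z | z.1 ≤ s}).ncard) {u : ℝ≥0} (hu : v < u) :
    h u - Function.leftLim h u = (A ∩ {z | z.1 = u}).ncard := by
  have hfin : (A ∩ {z | z.1 < u}).Finite :=
    (hA u).subset (Set.inter_subset_inter_right _ fun z (hz : z.1 < u) => hz.le)
  have hfin' : (A ∩ {z | z.1 = u}).Finite :=
    (hA u).subset (Set.inter_subset_inter_right _ fun z (hz : z.1 = u) => hz.le)
  have : (nhdsWithin u (Set.Iio u)).NeBot := nhdsLT_neBot_of_exists_lt ⟨v, hu⟩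
  have hlim : Function.leftLim h u = (A ∩ {z | z.1 < u}).ncard := by
    apply leftLim_eq_of_tendsto
    apply tendsto_const_nhds.congr'
    filter_upwards [eventually_left_inter_eq hA u, nhdsWithin_le_nhds (Ioi_mem_nhds hu)]
      with w hw hvw
    rw [hh w (le_of_lt hvw), hw]
  have hsplit : A ∩ {z | z.1 ≤ u} = (A ∩ {z | z.1 < u}) ∪ (A ∩ {z | z.1 = u}) := by
    rw [← Set.inter_union_distrib_left]
    congr 1
    ext z
    exact le_iff_lt_or_eq (a := z.1) (b := u)
  have hdisj : Disjoint (A ∩ {z | z.1 < u}) (A ∩ {z | z.1 = u}) :=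
    Set.disjoint_left.2 fun z hz hz' => ne_of_lt (show z.1 < u from hz.2) hz'.2
  rw [hlim, hh u hu.le, hsplit, Set.ncard_union_eq hdisj hfin hfin']
  push_cast
  ring

/-- The Stieltjes integral against the counting path of a set of marks is a sum over these marks,
even if several of them share a time. -/
theorem jumpIntegral_eq (hA : ∀ s, (A ∩ {z | z.1 ≤ s}).Finite) (hAv : ∀ z ∈ A, v < z.1)
    (hh : ∀ s, v ≤ s → h s = (A ∩ {z | z.1 ≤ s}).ncard) (f : ℝ≥0 → ℝ) (s : ℝ≥0) :
    jumpIntegral f h v s = ∑ᶠ z ∈ A ∩ {z | z.1 < s}, f z.1 := by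
  classical
  have hfin : (A ∩ {z | z.1 < s}).Finite :=
    (hA s).subset (Set.inter_subset_inter_right _ fun z (hz : z.1 < s) => hz.le)
  have h1 : jumpIntegral f h v s
      = ∑ᶠ u ∈ Set.Ioo v s, f u * ((A ∩ {z | z.1 = u}).ncard : ℝ) := by
    refine finsum_mem_congr rfl fun u hu => ?_
    rw [jump_eq hA hh hu.1]
  rw [h1, finsum_mem_eq_finite_toFinset_sum _ hfin,
    ← Finset.sum_fiberwise_of_maps_to (t := hfin.toFinset.image fun z => z.1) (g := fun z => z.1)
      fun z hz => Finset.mem_image_of_mem _ hz]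
  rw [finsum_mem_eq_sum_of_inter_support_eq (t := hfin.toFinset.image fun z => z.1)]
  · refine Finset.sum_congr rfl fun u hu => ?_
    have hu' : u < s := by
      obtain ⟨z, hz, rfl⟩ := Finset.mem_image.1 hu
      exact ((hfin.mem_toFinset).1 hz).2
    have hset : A ∩ {z | z.1 = u}
        = ((hfin.toFinset.filter fun z => z.1 = u : Finset Mark) : Set Mark) := by
      ext z
      simp only [Set.mem_inter_iff, Set.mem_ofPred_eq, Finset.coe_filter, Set.Finite.mem_toFinset]
      constructor
      · rintro ⟨hz, rfl⟩
        exact ⟨⟨hz, hu'⟩, rfl⟩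
      · rintro ⟨⟨hz, -⟩, h⟩
        exact ⟨hz, h⟩
    rw [hset, Set.ncard_coe_finset, mul_comm, ← nsmul_eq_mul, ← Finset.sum_const]
    refine Finset.sum_congr rfl fun z hz => ?_
    rw [(Finset.mem_filter.1 hz).2]
  · ext u
    simp only [Set.mem_inter_iff, Function.mem_support, Finset.coe_image, Set.mem_image]
    refine and_congr_left fun hu => ⟨fun hus => ?_, ?_⟩
    · have hne : (A ∩ {z | z.1 = u}).Nonempty := by
        rw [Set.nonempty_iff_ne_empty]
        intro h
        simp [h] at hu
      obtain ⟨z, hz, rfl⟩ := hne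
      exact ⟨z, by simpa using ⟨hz, hus.2⟩, rfl⟩
    · rintro ⟨z, hz, rfl⟩
      have hz' := (hfin.mem_toFinset).1 hz
      exact ⟨hAv z hz'.1, hz'.2⟩

end JumpIntegral

theorem setIntegral_config {ω : Config} {v s : ℝ≥0} {D : Set Mark} {p : Mark → Prop}
    [DecidablePred p] (f : Mark → ℝ) (hD : D.Finite)
    (hDp : ∀ z, z ∈ D ↔ (z ∈ atoms ω ∧ v < z.1 ∧ z.1 ≤ s ∧ p z)) :
    ∫ z in Set.Ioc v s ×ˢ Set.univ, (if p z then f z else 0) ∂ω.1 = ∑ᶠ z ∈ D, f z := by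
  rw [← integral_indicator (measurableSet_Ioc.prod MeasurableSet.univ),
    config_integral _ hD (fun z hz => ((hDp z).1 hz).1)]
  · refine finsum_mem_congr rfl fun z hz => ?_
    obtain ⟨-, h1, h2, h3⟩ := (hDp z).1 hz
    have h4 : z ∈ Set.Ioc v s ×ˢ (Set.univ : Set (ℝ≥0 × ℝ)) := ⟨⟨h1, h2⟩, Set.mem_univ _⟩
    rw [Set.indicator_of_mem h4, if_pos h3]
  · intro z hz hzD
    by_cases h : z ∈ Set.Ioc v s ×ˢ (Set.univ : Set (ℝ≥0 × ℝ))
    · rw [Set.indicator_of_mem h, if_neg fun hp => hzD ((hDp z).2 ⟨hz, h.1.1, h.1.2, hp⟩)]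
    · rw [Set.indicator_of_notMem h]

theorem kept_inter_finite_of_lt_top {v : ℝ≥0} {L ℓ : ℝ≥0 → ℝ} {ω : Config} {s : ℝ≥0}
    (h : ω.1 {z | z.1 ∈ Set.Ioc v s ∧ L z.1 ≤ (z.2.1 : ℝ) ∧ (z.2.1 : ℝ) ≤ L z.1 + ℓ z.1} < ∞) :
    (kept v L ℓ ω ∩ {z | z.1 ≤ s}).Finite :=
  ((config_apply_lt_top_iff ω _).1 h).subset fun _ hz =>
    ⟨hz.1.1, ⟨hz.1.2.1, hz.2⟩, hz.1.2.2⟩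

theorem lt_top_of_kept_inter_finite {v : ℝ≥0} {L ℓ : ℝ≥0 → ℝ} {ω : Config} {s : ℝ≥0}
    (h : (kept v L ℓ ω ∩ {z | z.1 ≤ s}).Finite) :
    ω.1 {z | z.1 ∈ Set.Ioc v s ∧ L z.1 ≤ (z.2.1 : ℝ) ∧ (z.2.1 : ℝ) ≤ L z.1 + ℓ z.1} < ∞ :=
  (config_apply_lt_top_iff ω _).2 <| h.subset fun _ hz => ⟨⟨hz.1, hz.2.1.1, hz.2.2⟩, hz.2.1.2⟩

section Equation

variable {m : ℝ≥0 → ℝ} {Φ : ℝ≥0 → ℝ≥0} {L : ℝ≥0 → ℝ} {v : ℝ≥0} {ω : Config}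
  {X H ℓ : ℝ≥0 → ℝ}

theorem kept_jumpIntegral (hfin : ∀ s, (kept v L ℓ ω ∩ {z | z.1 ≤ s}).Finite)
    (hH : ∀ s, v ≤ s → H s = ∑ᶠ _z ∈ kept v L ℓ ω ∩ {z | z.1 ≤ s}, (1 : ℝ)) (f : ℝ≥0 → ℝ)
    (s : ℝ≥0) :
    jumpIntegral f H v s = ∑ᶠ z ∈ kept v L ℓ ω ∩ {z | z.1 < s}, f z.1 :=
  jumpIntegral_eq hfin (fun _ hz => hz.2.1)
    (fun s hs => by rw [hH s hs, finsum_one_eq_ncard (hfin s)]) f s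

theorem solvesHawkes_iff {μ : ℝ} :
    SolvesHawkes μ Φ ω X H ℓ ↔ SolvesThinning (fun _ => μ) Φ 0 0 ω X H ℓ := by
  have hmem : ∀ s z, z ∈ kept 0 0 ℓ ω ∩ {z | z.1 ≤ s} ↔
      (z ∈ atoms ω ∧ 0 < z.1 ∧ z.1 ≤ s ∧ (z.2.1 : ℝ) ≤ ℓ z.1) := by
    intro s z
    simp only [kept, Set.mem_inter_iff, Set.mem_ofPred_eq, Pi.zero_apply, zero_add,
      NNReal.coe_nonneg, true_and]
    tauto
  have hset : ∀ s, {z : Mark | z.1 ∈ Set.Ioc 0 s ∧ (z.2.1 : ℝ) ≤ ℓ z.1} = {z : Mark |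
      z.1 ∈ Set.Ioc 0 s ∧ (0 : ℝ≥0 → ℝ) z.1 ≤ (z.2.1 : ℝ) ∧
        (z.2.1 : ℝ) ≤ (0 : ℝ≥0 → ℝ) z.1 + ℓ z.1} := by
    intro s
    simp
  constructor
  · intro h
    have hfin : ∀ s, (kept 0 0 ℓ ω ∩ {z | z.1 ≤ s}).Finite := fun s =>
      kept_inter_finite_of_lt_top (hset s ▸ h.finite s)
    have hH : ∀ s, 0 ≤ s → H s = ∑ᶠ _z ∈ kept 0 0 ℓ ω ∩ {z | z.1 ≤ s}, (1 : ℝ) := fun s _ => by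
      rw [h.H_eq s]
      exact setIntegral_config (fun _ => (1 : ℝ)) (hfin s) (hmem s)
    refine ⟨hfin, hH, fun s _ => ?_, fun s _ => ?_⟩
    · rw [h.X_eq s]
      exact setIntegral_config (fun z => z.2.2) (hfin s) (hmem s)
    · rw [h.lam_eq s, kept_jumpIntegral hfin hH]
  · intro h
    refine ⟨fun s => ?_, fun s => ?_, fun s => ?_, fun s => ?_⟩
    · rw [hset]
      exact lt_top_of_kept_inter_finite (h.finite s)
    · rw [h.X_eq s zero_le]
      exact (setIntegral_config (fun z => z.2.2) (h.finite s) (hmem s)).symm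
    · rw [h.H_eq s zero_le]
      exact (setIntegral_config (fun _ => (1 : ℝ)) (h.finite s) (hmem s)).symm
    · rw [h.lam_eq s zero_le, kept_jumpIntegral h.finite h.H_eq]

theorem solvesShifted_iff :
    SolvesShifted Φ L v ω X H ℓ ↔ SolvesThinning (shiftedBase Φ v) Φ L v ω X H ℓ := by
  have hmem : ∀ s z, z ∈ kept v L ℓ ω ∩ {z | z.1 ≤ s} ↔
      (z ∈ atoms ω ∧ v < z.1 ∧ z.1 ≤ s ∧ L z.1 ≤ (z.2.1 : ℝ) ∧
        (z.2.1 : ℝ) ≤ L z.1 + ℓ z.1) := by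
    intro s z
    simp only [kept, Set.mem_inter_iff, Set.mem_ofPred_eq]
    tauto
  constructor
  · intro h
    have hfin : ∀ s, (kept v L ℓ ω ∩ {z | z.1 ≤ s}).Finite := by
      intro s
      rcases le_total v s with hs | hs
      · exact kept_inter_finite_of_lt_top (h.finite s hs)
      · refine Set.finite_empty.subset fun z hz => ?_
        exact absurd (lt_of_lt_of_le hz.1.2.1 (show z.1 ≤ s from hz.2)) (not_lt.2 hs)
    have hH : ∀ s, v ≤ s → H s = ∑ᶠ _z ∈ kept v L ℓ ω ∩ {z | z.1 ≤ s}, (1 : ℝ) := fun s hs => by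
      rw [h.H_eq s hs]
      exact setIntegral_config (fun _ => (1 : ℝ)) (hfin s) (hmem s)
    refine ⟨hfin, hH, fun s hs => ?_, fun s hs => ?_⟩
    · rw [h.X_eq s hs]
      exact setIntegral_config (fun z => z.2.2) (hfin s) (hmem s)
    · rw [← kept_jumpIntegral hfin hH (fun u => (Φ (s - u) : ℝ)) s]
      rcases hs.eq_or_lt with rfl | hs
      · simp [h.lam_init, shiftedBase, jumpIntegral]
      · rw [h.lam_eq s hs, shiftedBase, if_pos hs]
  · intro h
    refine ⟨fun s _ => lt_top_of_kept_inter_finite (h.finite s), fun s hs => ?_, fun s hs => ?_,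
      fun s hs => ?_, ?_⟩
    · rw [h.H_eq s hs]
      exact (setIntegral_config (fun _ => (1 : ℝ)) (h.finite s) (hmem s)).symm
    · rw [h.X_eq s hs]
      exact (setIntegral_config (fun z => z.2.2) (h.finite s) (hmem s)).symm
    · rw [h.lam_eq s hs.le, kept_jumpIntegral h.finite h.H_eq, shiftedBase, if_pos hs]
    · rw [h.lam_eq v le_rfl,
        ← kept_jumpIntegral h.finite h.H_eq (fun u => (Φ (v - u) : ℝ)) v]
      simp [shiftedBase, jumpIntegral]

/-- Pathwise uniqueness: at the first time at which two solutions keep different atoms, the two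
intensities still agree, so that they keep the same atoms there after all. -/
theorem SolvesThinning.kept_eq {X' H' ℓ' : ℝ≥0 → ℝ} (h : SolvesThinning m Φ L v ω X H ℓ)
    (h' : SolvesThinning m Φ L v ω X' H' ℓ') : kept v L ℓ ω = kept v L ℓ' ω := by
  by_contra hne
  set D := {z | ¬ (z ∈ kept v L ℓ ω ↔ z ∈ kept v L ℓ' ω)} with hDdef
  obtain ⟨z₀, hz₀⟩ : D.Nonempty := by
    rw [Set.nonempty_iff_ne_empty]
    intro hD
    refine hne (Set.ext fun z => ?_)
    by_contra hz
    exact (hD ▸ (show z ∈ D from hz) : z ∈ (∅ : Set Mark))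
  have hfin : (D ∩ {z | z.1 ≤ z₀.1}).Finite := by
    refine ((h.finite z₀.1).union (h'.finite z₀.1)).subset fun z hz => ?_
    by_cases hzk : z ∈ kept v L ℓ ω
    · exact Or.inl ⟨hzk, hz.2⟩
    · refine Or.inr ⟨?_, hz.2⟩
      by_contra hzk'
      exact hz.1 ⟨fun h => absurd h hzk, fun h => absurd h hzk'⟩
  obtain ⟨z, hz, hmin⟩ := Set.exists_min_image _ (fun z : Mark => z.1) hfin
    ⟨z₀, hz₀, le_refl z₀.1⟩
  have hagree : kept v L ℓ ω ∩ {w | w.1 < z.1} = kept v L ℓ' ω ∩ {w | w.1 < z.1} := by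
    ext w
    refine and_congr_left fun (hw : w.1 < z.1) => ?_
    by_contra hcon
    exact absurd (hmin w ⟨hcon, hw.le.trans hz.2⟩) (not_le.2 hw)
  have hzv : v < z.1 := by
    by_contra hv
    exact hz.1 ⟨fun h => absurd h.2.1 hv, fun h => absurd h.2.1 hv⟩
  have hℓ : ℓ z.1 = ℓ' z.1 := by
    rw [h.lam_eq _ hzv.le, h'.lam_eq _ hzv.le, hagree]
  exact hz.1 (by simp only [kept, Set.mem_ofPred_eq, hℓ])

theorem SolvesThinning.unique {X' H' ℓ' : ℝ≥0 → ℝ} (h : SolvesThinning m Φ L v ω X H ℓ)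
    (h' : SolvesThinning m Φ L v ω X' H' ℓ') {s : ℝ≥0} (hs : v ≤ s) :
    X s = X' s ∧ H s = H' s ∧ ℓ s = ℓ' s := by
  rw [h.X_eq s hs, h.H_eq s hs, h.lam_eq s hs, h'.X_eq s hs, h'.H_eq s hs, h'.lam_eq s hs,
    h.kept_eq h']
  exact ⟨rfl, rfl, rfl⟩

theorem SolvesThinning.intensity_nonneg (h : SolvesThinning m Φ L v ω X H ℓ) {s : ℝ≥0} (hs : v ≤ s)
    (hm : 0 ≤ m s) : 0 ≤ ℓ s := by
  rw [h.lam_eq s hs]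
  exact add_nonneg hm (finsum_nonneg fun _ => finsum_nonneg fun _ => NNReal.coe_nonneg _)

theorem SolvesThinning.isCountingPath (h : SolvesThinning m Φ L v ω X H ℓ)
    (hsimple : ∀ z ∈ atoms ω, ∀ z' ∈ atoms ω, z.1 = z'.1 → z = z') : IsCountingPath v H := by
  have hH : ∀ s, v ≤ s → H s = (kept v L ℓ ω ∩ {z | z.1 ≤ s}).ncard := fun s hs => by
    rw [h.H_eq s hs, finsum_one_eq_ncard (h.finite s)]
  refine ⟨fun s hs => ⟨_, hH s hs⟩, fun s hs r hr hsr => ?_, fun s hs => ?_, fun s hs => ?_⟩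
  · rw [hH s hs, hH r hr]
    exact_mod_cast Set.ncard_le_ncard
      (Set.inter_subset_inter_right _ fun z hz => le_trans (show z.1 ≤ s from hz) hsr) (h.finite r)
  · -- Just after time `s` there are no further kept atoms.
    have hs1 : s < s + 1 := lt_add_of_pos_right s one_pos
    have h1 : ∀ᶠ w in nhds s, ∀ z ∈ kept v L ℓ ω ∩ {z | z.1 ≤ s + 1}, s < z.1 → w < z.1 := by
      rw [Filter.eventually_all_finite (h.finite (s + 1))]
      intro z _
      by_cases hz : s < z.1
      · filter_upwards [Iio_mem_nhds hz] with w hw _ using hw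
      · exact Filter.Eventually.of_forall fun w hw => absurd hw hz
    have h2 : ∀ᶠ w in nhdsWithin s (Set.Ici s), H s = H w := by
      filter_upwards [nhdsWithin_le_nhds h1, nhdsWithin_le_nhds (Iio_mem_nhds hs1),
        self_mem_nhdsWithin] with w hw hw1 hsw
      rw [hH s hs, hH w (hs.trans hsw)]
      congr 2
      ext z
      refine and_congr_right fun hz => ⟨fun hzs => le_trans (show z.1 ≤ s from hzs) hsw,
        fun hzw => ?_⟩
      by_contra hzs
      exact absurd (show z.1 ≤ w from hzw) (not_le.2 (hw z
        ⟨hz, le_trans (show z.1 ≤ w from hzw) (le_of_lt hw1)⟩ (not_le.1 hzs)))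
    exact tendsto_const_nhds.congr' h2
  · rw [jump_eq h.finite hH hs]
    have : (kept v L ℓ ω ∩ {z | z.1 = s}).Subsingleton := fun z hz z' hz' =>
      hsimple z hz.1.1 z' hz'.1.1 ((show z.1 = s from hz.2).trans (show z'.1 = s from hz'.2).symm)
    have hfin := this.finite.to_subtype
    exact_mod_cast Set.ncard_le_one_iff_subsingleton.2 this

end Equation

/-! ### Adding an atom to a solution -/

section Shift

variable {μ : ℝ} {Φ : ℝ≥0 → ℝ≥0} {ω : Config} {X H lam hX hH hlam : ℝ≥0 → ℝ} {t θ : ℝ≥0} {x : ℝ}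

open Classical in
theorem finsum_mem_insert_union_inter {K B R : Set Mark} {z : Mark} (f : Mark → ℝ) (hzK : z ∉ K)
    (hzB : z ∉ B) (hKB : Disjoint K B) (hK : (K ∩ R).Finite) (hB : (B ∩ R).Finite) :
    ∑ᶠ w ∈ insert z (K ∪ B) ∩ R, f w
      = ∑ᶠ w ∈ K ∩ R, f w + ((if z ∈ R then f z else 0) + ∑ᶠ w ∈ B ∩ R, f w) := by
  have hU : ∑ᶠ w ∈ (K ∪ B) ∩ R, f w = ∑ᶠ w ∈ K ∩ R, f w + ∑ᶠ w ∈ B ∩ R, f w := by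
    rw [Set.union_inter_distrib_right, finsum_mem_union
      (hKB.mono Set.inter_subset_left Set.inter_subset_left) hK hB]
  by_cases hz : z ∈ R
  · rw [Set.insert_inter_of_mem hz, finsum_mem_insert, hU, if_pos hz]
    · ring
    · rintro ⟨h | h, -⟩
      exacts [hzK h, hzB h]
    · rw [Set.union_inter_distrib_right]
      exact hK.union hB
  · rw [Set.insert_inter_of_notMem hz, hU, if_neg hz, zero_add]

open Classical in
/-- After an atom `(t, θ, x)` with `θ ≤ λ_t` has been added to the configuration, the intensity is
`λ` up to time `t`, and it is raised by the shifted intensity afterwards: the atoms below the new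
intensity are the new atom, those below `λ`, and those between `λ` and the new intensity. -/
theorem SolvesThinning.shift (ht : 0 < t)
    (h : SolvesThinning (fun _ => μ) Φ 0 0 ω X H lam)
    (h' : SolvesThinning (shiftedBase Φ t) Φ lam t ω hX hH hlam)
    (hatoms : ∀ z ∈ atoms ω, z.1 ≠ t) (hne : ∀ z ∈ atoms ω, 0 < z.1 → lam z.1 ≠ z.2.1)
    (hθ : (θ : ℝ) ≤ lam t) :
    SolvesThinning (fun _ => μ) Φ 0 0 (shift (t, θ, x) ω)
      (fun s => X s + if t ≤ s then x + hX s else 0)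
      (fun s => H s + if t ≤ s then 1 + hH s else 0)
      (fun s => lam s + if t ≤ s then hlam s else 0) := by
  have hbase : ∀ s, 0 ≤ shiftedBase Φ t s := fun s => by
    rw [shiftedBase]
    split_ifs
    exacts [NNReal.coe_nonneg _, le_rfl]
  have hinit : hlam t = 0 := (solvesShifted_iff.2 h').lam_init
  set K := kept 0 0 lam ω
  set B := kept t lam hlam ω
  have hK' : kept 0 0 (fun s => lam s + if t ≤ s then hlam s else 0)
      (HawkesMalliavin.shift (t, θ, x) ω) = insert (t, θ, x) (K ∪ B) := by
    ext z
    simp only [K, B, kept, atoms_shift, Set.mem_insert_iff, Set.mem_union, Set.mem_ofPred_eq,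
      Pi.zero_apply, zero_add, NNReal.coe_nonneg, true_and]
    by_cases hz : z = (t, θ, x)
    · subst hz
      simp [ht, hinit, hθ]
    · simp only [hz, false_or]
      by_cases hzω : z ∈ atoms ω
      · rcases lt_or_gt_of_ne (hatoms z hzω) with hzt | hzt
        · simp [hzω, not_le.2 hzt, not_lt.2 hzt.le]
        · have h0 : 0 < z.1 := ht.trans hzt
          have := h'.intensity_nonneg hzt.le (hbase _)
          simp only [hzω, h0, hzt, hzt.le, if_true, true_and]
          constructor
          · intro hz1
            rcases le_total (z.2.1 : ℝ) (lam z.1) with h2 | h2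
            exacts [Or.inl h2, Or.inr ⟨h2, hz1⟩]
          · rintro (h1 | h1)
            exacts [by linarith, h1.2]
      · simp [hzω]
  have hzK : (t, θ, x) ∉ K := fun hz => hatoms _ hz.1 rfl
  have hzB : (t, θ, x) ∉ B := fun hz => hatoms _ hz.1 rfl
  -- An atom in both regions would lie on the graph of `λ`.
  have hKB : Disjoint K B := Set.disjoint_left.2 fun z hz hz' => by
    refine hne z hz.1 hz.2.1 (le_antisymm hz'.2.2.1 ?_)
    simpa using hz.2.2.2
  have hle : ∀ (f : Mark → ℝ) (s : ℝ≥0), ∑ᶠ w ∈ insert (t, θ, x) (K ∪ B) ∩ {z | z.1 ≤ s}, f w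
      = ∑ᶠ w ∈ K ∩ {z | z.1 ≤ s}, f w
        + if t ≤ s then f (t, θ, x) + ∑ᶠ w ∈ B ∩ {z | z.1 ≤ s}, f w else 0 := by
    intro f s
    rw [finsum_mem_insert_union_inter f hzK hzB hKB (h.finite s) (h'.finite s)]
    by_cases hts : t ≤ s
    · simp [hts]
    · have : B ∩ {z | z.1 ≤ s} = ∅ := Set.eq_empty_of_forall_notMem fun z hz =>
        hts (hz.1.2.1.le.trans hz.2)
      simp [hts, this]
  have hsub : ∀ s : ℝ≥0, {z : Mark | z.1 < s} ⊆ {z : Mark | z.1 ≤ s} :=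
    fun s z (hz : z.1 < s) => hz.le
  have hlt : ∀ (f : Mark → ℝ) (s : ℝ≥0), ∑ᶠ w ∈ insert (t, θ, x) (K ∪ B) ∩ {z | z.1 < s}, f w
      = ∑ᶠ w ∈ K ∩ {z | z.1 < s}, f w
        + if t < s then f (t, θ, x) + ∑ᶠ w ∈ B ∩ {z | z.1 < s}, f w else 0 := by
    intro f s
    rw [finsum_mem_insert_union_inter f hzK hzB hKB
      ((h.finite s).subset (Set.inter_subset_inter_right _ (hsub s)))
      ((h'.finite s).subset (Set.inter_subset_inter_right _ (hsub s)))]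
    by_cases hts : t < s
    · simp [hts]
    · have : B ∩ {z | z.1 < s} = ∅ := Set.eq_empty_of_forall_notMem fun z hz =>
        hts (hz.1.2.1.trans hz.2)
      simp [hts, this]
  refine ⟨fun s => ?_, fun s hs => ?_, fun s hs => ?_, fun s hs => ?_⟩
  · rw [hK']
    refine (((h.finite s).union (h'.finite s)).insert (t, θ, x)).subset ?_
    rintro z ⟨hz | hz | hz, hzs⟩
    exacts [Or.inl hz, Or.inr (Or.inl ⟨hz, hzs⟩), Or.inr (Or.inr ⟨hz, hzs⟩)]
  · rw [hK', hle, h.H_eq s hs]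
    congr 1
    split_ifs with hts
    · rw [h'.H_eq s hts]
    · rfl
  · rw [hK', hle, h.X_eq s hs]
    congr 1
    split_ifs with hts
    · rw [h'.X_eq s hts]
    · rfl
  · rw [hK', hlt, h.lam_eq s hs, add_assoc]
    congr 2
    rcases lt_trichotomy t s with hts | rfl | hts
    · rw [if_pos hts.le, if_pos hts, h'.lam_eq s hts.le, shiftedBase, if_pos hts]
    · -- At time `t` itself the new atom does not yet contribute, and `hlam` vanishes.
      rw [if_pos le_rfl, if_neg (lt_irrefl _), hinit]
    · rw [if_neg (not_le.2 hts), if_neg (not_lt.2 hts.le)]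

end Shift

/-! ### The predictable σ-algebra -/

/-- `ℝ₊ × Ω` with the predictable σ-algebra, as a type of its own so that this σ-algebra, and not
the product σ-algebra, is its instance. -/
def PredSpace : Type := ℝ≥0 × Config

instance : MeasurableSpace PredSpace := history.predictable

/-- `Ω` with the σ-algebra `F^N_s` as its instance. -/
def HistSpace (_s : ℝ≥0) : Type := Config

instance (s : ℝ≥0) : MeasurableSpace (HistSpace s) := history s

/-- The underlying configuration. -/
def HistSpace.config {s : ℝ≥0} (ω : HistSpace s) : Config := ω

namespace PredSpace

/-- The point `(u, ω)` of the predictable space. -/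
def mk (u : ℝ≥0) (ω : Config) : PredSpace := (u, ω)

/-- The time component. -/
def time (p : PredSpace) : ℝ≥0 := Prod.fst p

/-- The configuration component. -/
def config (p : PredSpace) : Config := Prod.snd p

@[simp] theorem time_mk (u : ℝ≥0) (ω : Config) : (mk u ω).time = u := rfl

@[simp] theorem config_mk (u : ℝ≥0) (ω : Config) : (mk u ω).config = ω := rfl

theorem measurableSet_zero {A : Set Config} (hA : MeasurableSet[history 0] A) :
    MeasurableSet {p : PredSpace | p.time = 0 ∧ p.config ∈ A} :=
  measurableSet_predictable_singleton_bot_prod (𝓕 := history) hA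

theorem measurableSet_lt {a : ℝ≥0} {A : Set Config} (hA : MeasurableSet[history a] A) :
    MeasurableSet {p : PredSpace | a < p.time ∧ p.config ∈ A} :=
  measurableSet_predictable_Ioi_prod (𝓕 := history) hA

theorem measurable_of {α : Type*} [MeasurableSpace α] {f : α → PredSpace}
    (h0 : ∀ A, MeasurableSet[history 0] A → MeasurableSet {x | (f x).time = 0 ∧ (f x).config ∈ A})
    (h1 : ∀ a A, MeasurableSet[history a] A →
      MeasurableSet {x | a < (f x).time ∧ (f x).config ∈ A}) : Measurable f := by
  refine measurable_generateFrom ?_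
  rintro _ (⟨A, hA, rfl⟩ | ⟨a, A, hA, rfl⟩)
  exacts [h0 A hA, h1 a A hA]

theorem measurable_time : Measurable PredSpace.time := by
  refine measurable_of_Ioi fun a => ?_
  have := measurableSet_lt (a := a) (A := Set.univ) MeasurableSet.univ
  convert this using 1
  ext p
  simp

theorem measurable_swap_mk : Measurable fun x : ℝ≥0 × Config => mk x.1 x.2 := by
  refine measurable_of (fun A hA => ?_) (fun a A hA => ?_)
  · exact (measurableSet_singleton (0 : ℝ≥0)).prod (history.le 0 _ hA)
  · exact measurableSet_Ioi.prod (history.le a _ hA)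

/-- The point `(u ∧ s, ω)` is measurable in `u` and the predictable point `(s, ω)`. It agrees
with `(u, ω)` for `u ≤ s`; beyond time `s` the point `(u, ω)` would look into the future. -/
theorem measurable_clip :
    Measurable fun x : PredSpace × ℝ≥0 => mk (min x.2 x.1.time) x.1.config := by
  refine measurable_of (fun A hA => ?_) (fun a A hA => ?_)
  · have h1 : MeasurableSet {x : PredSpace × ℝ≥0 | x.1.time = 0 ∧ x.1.config ∈ A} :=
      measurable_fst (measurableSet_zero hA)
    have h2 : MeasurableSet {x : PredSpace × ℝ≥0 | 0 < x.1.time ∧ x.1.config ∈ A} :=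
      measurable_fst (measurableSet_lt hA)
    have h3 : MeasurableSet {x : PredSpace × ℝ≥0 | x.2 = 0} :=
      measurable_snd (measurableSet_singleton (0 : ℝ≥0))
    convert (h3.inter (h1.union h2)).union h1 using 1
    ext x
    have := eq_zero_or_pos (a := x.1.time)
    simp only [time_mk, config_mk, Set.mem_ofPred_eq, Set.mem_inter_iff, Set.mem_union,
      min_eq_iff]
    constructor
    · rintro ⟨⟨h, -⟩ | ⟨h, -⟩, hA⟩
      · rcases this with h' | h' <;> simp [h, h', hA]
      · simp [h, hA]
    · rintro (⟨h, ⟨-, h'⟩ | ⟨-, h'⟩⟩ | ⟨h, h'⟩) <;> simp [h, h']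
  · have h2 : MeasurableSet {x : PredSpace × ℝ≥0 | a < x.1.time ∧ x.1.config ∈ A} :=
      measurable_fst (measurableSet_lt hA)
    have h3 : MeasurableSet {x : PredSpace × ℝ≥0 | a < x.2} := measurable_snd measurableSet_Ioi
    convert h3.inter h2 using 1
    ext x
    simp [and_assoc]

theorem measurable_clip_hist (s : ℝ≥0) :
    Measurable fun x : HistSpace s × ℝ≥0 => mk (min x.2 s) x.1 := by
  have hmeas : ∀ a ≤ s, ∀ A : Set Config, MeasurableSet[history a] A →
      MeasurableSet {x : HistSpace s × ℝ≥0 | (x.1 : Config) ∈ A} := by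
    intro a has A hA
    have : MeasurableSet (α := HistSpace s) A := history.mono has A hA
    exact measurable_fst this
  refine measurable_of (fun A hA => ?_) (fun a A hA => ?_)
  · refine MeasurableSet.inter ?_ (hmeas 0 zero_le A hA)
    exact (measurable_snd.min measurable_const) (measurableSet_singleton (0 : ℝ≥0))
  · rcases lt_or_ge a s with has | has
    · refine MeasurableSet.inter ?_ (hmeas a has.le A hA)
      exact (measurable_snd.min measurable_const) measurableSet_Ioi
    · convert MeasurableSet.empty using 1
      refine Set.eq_empty_of_forall_notMem fun x hx => ?_
      exact absurd (lt_of_lt_of_le hx.1 (min_le_right x.2 s)) (not_lt.2 has)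

/-- A process that is constant in time, started after time `a`, is predictable as soon as its
value is known at time `a`. -/
theorem measurable_ite_lt {a : ℝ≥0} {g : Config → ℝ≥0∞} (hg : Measurable[history a] g) :
    Measurable fun p : PredSpace => if a < p.time then g p.config else 0 := by
  refine measurable_of_Ioi fun c => ?_
  convert measurableSet_lt (a := a) (hg (measurableSet_Ioi (a := c))) using 1
  ext p
  by_cases h : a < p.time <;> simp [h]

end PredSpace

/-! ### Integrals of predictable integrands -/

/-- A kernel all of whose measures are finite is s-finite, although their masses need not be
bounded: it is the sum of its restrictions to the sets where the mass has integer part `n`. -/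
theorem isSFiniteKernel_of_lt_top {α β : Type*} [MeasurableSpace α] [MeasurableSpace β]
    (κ : Kernel α β) (h : ∀ a, κ a Set.univ < ∞) : IsSFiniteKernel κ := by
  classical
  have hS : ∀ n : ℕ, MeasurableSet {a | ⌊(κ a Set.univ).toNNReal⌋₊ = n} := fun n =>
    (Nat.measurable_floor.comp (κ.measurable_coe MeasurableSet.univ).ennreal_toNNReal)
      (measurableSet_singleton n)
  have hκ : κ = Kernel.sum fun n : ℕ => Kernel.piecewise (hS n) κ 0 := by
    ext1 a
    rw [Kernel.sum_apply]
    ext1 B hB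
    rw [Measure.sum_apply _ hB, tsum_eq_single ⌊(κ a Set.univ).toNNReal⌋₊]
    · simp [Kernel.piecewise_apply]
    · intro n hn
      simp [Kernel.piecewise_apply, hn.symm]
  rw [hκ]
  refine Kernel.isSFiniteKernel_sum (hκs := fun n => ?_)
  have : IsFiniteKernel (Kernel.piecewise (hS n) κ 0) := by
    refine ⟨(n : ℝ≥0∞) + 1, by simp, fun a => ?_⟩
    rw [Kernel.piecewise_apply]
    split_ifs with hn
    · have h1 : (κ a Set.univ).toNNReal < (n : ℝ≥0) + 1 := by
        have h2 : ⌊(κ a Set.univ).toNNReal⌋₊ = n := hn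
        rw [← h2]
        exact Nat.lt_floor_add_one _
      rw [← ENNReal.coe_toNNReal (h a).ne]
      exact_mod_cast h1.le
    · simp
  infer_instance

/-- The marks for which the larger one of time and height has integer part `n`. Every
configuration has finitely many atoms there. -/
def shell (n : ℕ) : Set Mark := {z | ⌊max z.1 z.2.1⌋₊ = n}

theorem measurableSet_shell (n : ℕ) : MeasurableSet (shell n) :=
  (Nat.measurable_floor.comp (measurable_fst.max (measurable_fst.comp measurable_snd)))
    (measurableSet_singleton n)

theorem config_shell_lt_top (ω : Config) (n : ℕ) : ω.1 (shell n) < ∞ := by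
  rw [config_apply_lt_top_iff]
  refine (isLocallyFinite_atoms ω (n + 1) (n + 1)).subset fun z hz => ⟨hz.1, ?_⟩
  have h : ⌊max z.1 z.2.1⌋₊ = n := hz.2
  have h1 : max z.1 z.2.1 < (n : ℝ≥0) + 1 := h ▸ Nat.lt_floor_add_one _
  exact ⟨(le_max_left _ _).trans h1.le, (le_max_right _ _).trans h1.le⟩

/-- A kernel all of whose measures are dominated by configurations is s-finite. -/
theorem isSFiniteKernel_of_le_config {α : Type*} [MeasurableSpace α] (κ : Kernel α Mark)
    (h : ∀ a, ∃ ω : Config, κ a ≤ ω.1) : IsSFiniteKernel κ := by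
  have hκ : κ = Kernel.sum fun n : ℕ => κ.restrict (measurableSet_shell n) := by
    ext1 a
    rw [Kernel.sum_apply]
    simp_rw [Kernel.restrict_apply]
    rw [← Measure.restrict_iUnion _ measurableSet_shell]
    · have : ⋃ n, shell n = Set.univ := Set.eq_univ_of_forall fun z =>
        Set.mem_iUnion.2 ⟨_, rfl⟩
      rw [this, Measure.restrict_univ]
    · exact fun i j hij => Set.disjoint_left.2 fun z (hz : _ = i) (hz' : _ = j) =>
        hij (hz.symm.trans hz')
  rw [hκ]
  refine Kernel.isSFiniteKernel_sum (hκs := fun n => isSFiniteKernel_of_lt_top _ fun a => ?_)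
  obtain ⟨ω, hω⟩ := h a
  rw [Kernel.restrict_apply, Measure.restrict_apply_univ]
  exact (hω _).trans_lt (config_shell_lt_top ω n)

theorem measurableSet_time_le (s : ℝ≥0) : MeasurableSet {z : Mark | z.1 ≤ s} :=
  measurable_fst measurableSet_Iic

theorem measurableSet_time_lt (s : ℝ≥0) : MeasurableSet {z : Mark | z.1 < s} :=
  measurable_fst measurableSet_Iio

theorem measurable_history_rect {s : ℝ≥0} {T : Set ℝ≥0} {B : Set (ℝ≥0 × ℝ)} (hT : MeasurableSet T)
    (hTs : T ⊆ Set.Iic s) (hB : MeasurableSet B) :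
    Measurable[history s] fun ω : Config => ω.1 (T ×ˢ B) := by
  rw [measurable_iff_comap_le]
  exact le_iSup_of_le T (le_iSup_of_le ⟨hT, hTs⟩ (le_iSup_of_le B (le_iSup_of_le hB le_rfl)))

/-- Counts of all measurable sets of marks up to time `s`, not only of rectangles, are known at
time `s`. -/
theorem measurable_history_apply {s : ℝ≥0} {B : Set Mark} (hB : MeasurableSet B)
    (hBs : B ⊆ {z | z.1 ≤ s}) : Measurable[history s] fun ω : Config => ω.1 B := by
  -- Bounding the heights makes the measures finite, which the π-λ argument needs.
  have h1 : ∀ n : ℕ, Measurable fun ω : HistSpace s =>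
      ω.config.1.restrict (Set.Iic s ×ˢ (Set.Iic (n : ℝ≥0) ×ˢ Set.univ)) := by
    intro n
    have hfin : ∀ ω : HistSpace s, IsFiniteMeasure
        (ω.config.1.restrict (Set.Iic s ×ˢ (Set.Iic (n : ℝ≥0) ×ˢ (Set.univ : Set ℝ)))) := by
      intro ω
      refine isFiniteMeasure_restrict.2 (LT.lt.ne ?_)
      refine (config_apply_lt_top_iff ω _).2 ((isLocallyFinite_atoms ω s n).subset ?_)
      exact fun z hz => ⟨hz.1, hz.2.1, hz.2.2.1⟩
    have hrect : ∀ (T : Set ℝ≥0) (B : Set (ℝ≥0 × ℝ)), MeasurableSet T → MeasurableSet B →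
        Measurable fun ω : HistSpace s =>
          ω.config.1.restrict (Set.Iic s ×ˢ (Set.Iic (n : ℝ≥0) ×ˢ Set.univ)) (T ×ˢ B) := by
      intro T B hT hB
      simp_rw [Measure.restrict_apply (hT.prod hB), Set.prod_inter_prod]
      exact measurable_history_rect (hT.inter measurableSet_Iic) Set.inter_subset_right
        (hB.inter (measurableSet_Iic.prod MeasurableSet.univ))
    refine Measurable.measure_of_isPiSystem generateFrom_prod.symm isPiSystem_prod ?_ ?_
    · rintro _ ⟨T, hT, B, hB, rfl⟩
      exact hrect T B hT hB
    · have := hrect _ _ MeasurableSet.univ MeasurableSet.univ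
      rwa [Set.univ_prod_univ] at this
  have h2 : ∀ ω : Config, ω.1 B
      = ⨆ n : ℕ, ω.1.restrict (Set.Iic s ×ˢ (Set.Iic (n : ℝ≥0) ×ˢ Set.univ)) B := by
    intro ω
    simp_rw [Measure.restrict_apply hB]
    rw [← Monotone.measure_iUnion, ← Set.inter_iUnion]
    · congr 1
      refine (Set.inter_eq_left.2 fun z hz => ?_).symm
      obtain ⟨n, hn⟩ := exists_nat_ge z.2.1
      exact Set.mem_iUnion.2 ⟨n, hBs hz, hn, Set.mem_univ _⟩
    · intro i j hij
      refine Set.inter_subset_inter_right _ (Set.prod_mono le_rfl (Set.prod_mono ?_ le_rfl))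
      exact Set.Iic_subset_Iic.2 (by exact_mod_cast hij)
  simp_rw [h2]
  have h3 : Measurable fun ω : HistSpace s =>
      ⨆ n : ℕ, ω.config.1.restrict (Set.Iic s ×ˢ (Set.Iic (n : ℝ≥0) ×ˢ Set.univ)) B :=
    Measurable.iSup fun n => (Measure.measurable_coe hB).comp (h1 n)
  exact h3

/-- The count of the atoms of a set strictly before the current time is predictable. -/
theorem measurable_pred_apply {B : Set Mark} (hB : MeasurableSet B) :
    Measurable fun p : PredSpace => p.config.1 (B ∩ {z | z.1 < p.time}) := by
  set r : ℚ → ℝ≥0 := fun q => Real.toNNReal q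
  have h : ∀ p : PredSpace, p.config.1 (B ∩ {z | z.1 < p.time}) = ⨆ q : ℚ,
      if r q < p.time then p.config.1 (B ∩ {z | z.1 ≤ r q}) else 0 := by
    intro p
    have hU : B ∩ {z | z.1 < p.time}
        = ⋃ q : ℚ, if r q < p.time then B ∩ {z | z.1 ≤ r q} else ∅ := by
      ext z
      simp only [Set.mem_iUnion]
      constructor
      · rintro ⟨hz, hzp⟩
        obtain ⟨q, -, hq1, hq2⟩ := (NNReal.lt_iff_exists_rat_btwn _ _).1 (Set.mem_ofPred.1 hzp)
        refine ⟨q, ?_⟩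
        rw [if_pos hq2]
        exact ⟨hz, hq1.le⟩
      · rintro ⟨q, hq⟩
        split_ifs at hq with hqp
        · exact ⟨hq.1, lt_of_le_of_lt (Set.mem_ofPred.1 hq.2) hqp⟩
        · exact absurd hq (Set.notMem_empty z)
    rw [hU, Directed.measure_iUnion]
    · congr 1
      ext q
      split_ifs <;> simp
    · have hmono : ∀ q q' : ℚ, r q ≤ r q' → r q' < p.time →
          (if r q < p.time then B ∩ {z | z.1 ≤ r q} else ∅)
            ⊆ if r q' < p.time then B ∩ {z | z.1 ≤ r q'} else ∅ := by
        intro q q' hqq' hq'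
        rw [if_pos (hqq'.trans_lt hq'), if_pos hq']
        exact Set.inter_subset_inter_right _ fun z hz => le_trans (Set.mem_ofPred.1 hz) hqq'
      intro q q'
      by_cases hq : r q < p.time
      · by_cases hq' : r q' < p.time
        · rcases le_total (r q) (r q') with hqq' | hqq'
          exacts [⟨q', hmono q q' hqq' hq', le_rfl⟩, ⟨q, le_rfl, hmono q' q hqq' hq⟩]
        · exact ⟨q, le_rfl, by simp [hq']⟩
      · exact ⟨q', by simp [hq], le_rfl⟩
  simp_rw [h]
  exact Measurable.iSup fun q => PredSpace.measurable_ite_lt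
    (measurable_history_apply (hB.inter (measurableSet_time_le _)) Set.inter_subset_right)

/-- The configuration before the current time, as a kernel. -/
def predKernel : Kernel PredSpace Mark where
  toFun p := p.config.1.restrict {z | z.1 < p.time}
  measurable' := by
    refine Measure.measurable_of_measurable_coe _ fun B hB => ?_
    simp_rw [Measure.restrict_apply hB]
    exact measurable_pred_apply hB

instance : IsSFiniteKernel predKernel :=
  isSFiniteKernel_of_le_config _ fun p => ⟨p.config, Measure.restrict_le_self⟩

/-- The configuration up to time `s`, as a kernel. -/
def histKernel (s : ℝ≥0) : Kernel (HistSpace s) Mark where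
  toFun ω := ω.config.1.restrict {z | z.1 ≤ s}
  measurable' := by
    refine Measure.measurable_of_measurable_coe _ fun B hB => ?_
    simp_rw [Measure.restrict_apply hB]
    exact measurable_history_apply (hB.inter (measurableSet_time_le s)) Set.inter_subset_right

instance (s : ℝ≥0) : IsSFiniteKernel (histKernel s) :=
  isSFiniteKernel_of_le_config _ fun ω => ⟨ω, Measure.restrict_le_self⟩

/-- The configuration as a kernel. -/
def configKernel : Kernel Config Mark where
  toFun ω := ω.1
  measurable' := measurable_subtype_coe

instance : IsSFiniteKernel configKernel :=
  isSFiniteKernel_of_le_config _ fun ω => ⟨ω, le_rfl⟩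

/-- The integral of a predictable integrand over the atoms strictly before the current time is
predictable; the integrand may also depend on the current time. -/
theorem measurable_predIntegral {F : PredSpace × (PredSpace × (ℝ≥0 × ℝ)) → ℝ≥0∞}
    (hF : Measurable F) : Measurable fun p : PredSpace =>
      ∫⁻ z in {z | z.1 < p.time}, F (p, (PredSpace.mk z.1 p.config, z.2)) ∂p.config.1 := by
  have hmap : Measurable fun x : PredSpace × Mark =>
      F (x.1, (PredSpace.mk (min x.2.1 x.1.time) x.1.config, x.2.2)) :=
    hF.comp (measurable_fst.prodMk ((PredSpace.measurable_clip.comp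
      (measurable_fst.prodMk (measurable_fst.comp measurable_snd))).prodMk
        (measurable_snd.comp measurable_snd)))
  have h := hmap.lintegral_kernel_prod_right' (κ := predKernel)
  convert h using 2 with p
  refine setLIntegral_congr_fun (measurableSet_time_lt _) fun z hz => ?_
  simp only [min_eq_left (le_of_lt (Set.mem_ofPred.1 hz))]

/-- The integral of a predictable integrand up to time `s` is known at time `s`. -/
theorem measurable_histIntegral (s : ℝ≥0) {F : PredSpace × (ℝ≥0 × ℝ) → ℝ} (hF : Measurable F) :
    Measurable[history s] fun ω : Config =>
      ∫ z in {z | z.1 ≤ s}, F (PredSpace.mk z.1 ω, z.2) ∂ω.1 := by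
  have hmap : Measurable fun x : HistSpace s × Mark =>
      F (PredSpace.mk (min x.2.1 s) x.1.config, x.2.2) :=
    hF.comp (((PredSpace.measurable_clip_hist s).comp
      (measurable_fst.prodMk (measurable_fst.comp measurable_snd))).prodMk
        (measurable_snd.comp measurable_snd))
  have h : Measurable fun ω : HistSpace s =>
      ∫ z, F (PredSpace.mk (min z.1 s) ω.config, z.2) ∂(histKernel s ω) :=
    (hmap.stronglyMeasurable.integral_kernel_prod_right' (κ := histKernel s)).measurable
  have h' : (fun ω : Config => ∫ z in {z | z.1 ≤ s}, F (PredSpace.mk z.1 ω, z.2) ∂ω.1)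
      = fun ω => ∫ z in {z : Mark | z.1 ≤ s}, F (PredSpace.mk (min z.1 s) ω, z.2) ∂ω.1 := by
    ext ω
    refine setIntegral_congr_fun (measurableSet_time_le _) fun z hz => ?_
    simp only [min_eq_left (Set.mem_ofPred.1 hz)]
  rw [h']
  exact h

/-! ### Lebesgue measure on the half-line -/

theorem lintegral_lebesgue (f : ℝ → ℝ≥0∞) :
    ∫⁻ u : ℝ≥0, f u ∂lebesgue = ∫⁻ x in Set.Ici (0 : ℝ), f x :=
  lintegral_subtype_comap (s := Set.Ici (0 : ℝ)) measurableSet_Ici f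

theorem lebesgue_apply {S : Set ℝ≥0} (hS : MeasurableSet S) :
    lebesgue S = volume ((↑) '' S : Set ℝ) :=
  Measure.comap_apply _ NNReal.coe_injective
    (fun _ h => (MeasurableEmbedding.subtype_coe
      (measurableSet_Ici (a := (0 : ℝ)))).measurableSet_image.2 h) _ hS

theorem lebesgue_Icc (a b : ℝ≥0) : lebesgue (Set.Icc a b) = b - a := by
  rw [lebesgue_apply measurableSet_Icc, NNReal.image_coe_Icc, Real.volume_Icc,
    ENNReal.ofReal_sub _ (NNReal.coe_nonneg a), ENNReal.ofReal_coe_nnreal,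
    ENNReal.ofReal_coe_nnreal]

theorem lebesgue_Ico (a b : ℝ≥0) : lebesgue (Set.Ico a b) = b - a := by
  rw [lebesgue_apply measurableSet_Ico, NNReal.image_coe_Ico, Real.volume_Ico,
    ENNReal.ofReal_sub _ (NNReal.coe_nonneg a), ENNReal.ofReal_coe_nnreal,
    ENNReal.ofReal_coe_nnreal]

theorem lebesgue_Iic (a : ℝ≥0) : lebesgue (Set.Iic a) = a := by
  have h := lebesgue_Icc 0 a
  rwa [ENNReal.coe_zero, tsub_zero, ← bot_eq_zero, Set.Icc_bot] at h

theorem lebesgue_singleton (a : ℝ≥0) : lebesgue {a} = 0 := by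
  rw [← Set.Icc_self, lebesgue_Icc, tsub_self]

instance : SigmaFinite lebesgue := by
  refine ⟨⟨⟨fun n : ℕ => Set.Iic (n : ℝ≥0), fun _ => trivial, fun n => ?_, ?_⟩⟩⟩
  · rw [lebesgue_Iic]
    exact ENNReal.coe_lt_top
  · exact Set.eq_univ_of_forall fun u => Set.mem_iUnion.2 (exists_nat_ge u)

/-- Lebesgue measure on the half-line is invariant under translation to the right. -/
theorem lintegral_lebesgue_shift (f : ℝ≥0 → ℝ≥0∞) (u : ℝ≥0) :
    ∫⁻ s in Set.Ioi u, f (s - u) ∂lebesgue = ∫⁻ s, f s ∂lebesgue := by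
  have h1 : ∀ g : ℝ≥0 → ℝ≥0∞,
      ∫⁻ s, g s ∂lebesgue = ∫⁻ x : ℝ, (Set.Ioi (0 : ℝ)).indicator (fun x => g x.toNNReal) x := by
    intro g
    have := lintegral_lebesgue fun x => g x.toNNReal
    simp only [Real.toNNReal_coe] at this
    rw [this, lintegral_indicator measurableSet_Ioi, setLIntegral_congr Ioi_ae_eq_Ici]
  rw [← lintegral_indicator measurableSet_Ioi, h1, h1 f, ← lintegral_sub_right_eq_self
    (fun x : ℝ => (Set.Ioi (0 : ℝ)).indicator (fun x => f x.toNNReal) x) (u : ℝ)]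
  refine lintegral_congr fun x => ?_
  by_cases hx : (u : ℝ) < x
  · have hx0 : 0 < x := (NNReal.coe_nonneg u).trans_lt hx
    have hxu : u < x.toNNReal := by rwa [Real.lt_toNNReal_iff_coe_lt]
    have hx' : x ∈ Set.Ioi (0 : ℝ) := hx0
    have hxu' : x.toNNReal ∈ Set.Ioi u := hxu
    have hsub : x - u ∈ Set.Ioi (0 : ℝ) := sub_pos.2 hx
    simp only [Set.indicator_of_mem hx', Set.indicator_of_mem hxu', Set.indicator_of_mem hsub]
    rw [NNReal.sub_def, Real.coe_toNNReal x hx0.le]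
  · have hxu : x.toNNReal ∉ Set.Ioi u := fun h => hx (Real.lt_toNNReal_iff_coe_lt.1 h)
    have hsub : x - u ∉ Set.Ioi (0 : ℝ) := fun h => hx (sub_pos.1 h)
    simp [Set.indicator_of_notMem hsub, Set.indicator_of_notMem hxu]

section Intensity

variable (ν : Measure ℝ) [IsProbabilityMeasure ν]

instance : SigmaFinite (intensityMeasure ν) := by
  unfold intensityMeasure
  infer_instance

theorem intensityMeasure_box (S T : Set ℝ≥0) :
    intensityMeasure ν (S ×ˢ (T ×ˢ Set.univ)) = lebesgue S * lebesgue T := by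
  rw [intensityMeasure, Measure.prod_prod, Measure.prod_prod, measure_univ, mul_one]

theorem intensityMeasure_time_eq (t : ℝ≥0) : intensityMeasure ν {z | z.1 = t} = 0 := by
  have : {z : Mark | z.1 = t} = {t} ×ˢ Set.univ := by
    ext z
    simp
  rw [this, intensityMeasure, Measure.prod_prod, lebesgue_singleton, zero_mul]

theorem lintegral_intensityMeasure {f : Mark → ℝ≥0∞} (hf : Measurable f) :
    ∫⁻ z, f z ∂(intensityMeasure ν) = ∫⁻ u, ∫⁻ θ, ∫⁻ y, f (u, θ, y) ∂ν ∂lebesgue ∂lebesgue := by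
  rw [intensityMeasure, lintegral_prod _ hf.aemeasurable]
  refine lintegral_congr fun u => ?_
  exact lintegral_prod _ (hf.comp measurable_prodMk_left).aemeasurable

end Intensity

/-! ### Consequences of the Poisson law -/

theorem tsum_mul_poissonMeasure_singleton (r : ℝ≥0) :
    ∑' n : ℕ, (n : ℝ≥0∞) * poissonMeasure r {n} = r := by
  have h : ∀ n : ℕ, ((n + 1 : ℕ) : ℝ≥0∞) * poissonMeasure r {n + 1}
      = r * poissonMeasure r {n} := by
    intro n
    rw [poissonMeasure_singleton, poissonMeasure_singleton, ← ENNReal.ofReal_natCast,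
      ← ENNReal.ofReal_coe_nnreal, ← ENNReal.ofReal_mul (by positivity),
      ← ENNReal.ofReal_mul (by positivity)]
    congr 1
    rw [Nat.factorial_succ]
    push_cast
    field_simp
    ring
  rw [tsum_eq_zero_add' ENNReal.summable]
  simp_rw [h]
  rw [ENNReal.tsum_mul_left]
  have h1 : ∑' n : ℕ, poissonMeasure r {n} = 1 := by
    rw [← measure_univ (μ := poissonMeasure r),
      ← Measure.tsum_indicator_apply_singleton _ _ MeasurableSet.univ]
    simp
  simp [h1]

section Poisson

variable {ν : Measure ℝ} [IsProbabilityMeasure ν] {P : Measure Config} [IsProbabilityMeasure P]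
  {I : Measure Mark}

theorem measurable_config_apply {B : Set Mark} (hB : MeasurableSet B) :
    Measurable fun ω : Config => ω.1 B :=
  (Measure.measurable_coe hB).comp measurable_subtype_coe

theorem IsPoissonRandomMeasure.lintegral_apply_of_lt_top (hP : IsPoissonRandomMeasure P I)
    {B : Set Mark} (hB : MeasurableSet B) (hIB : I B < ∞) : ∫⁻ ω, ω.1 B ∂P = I B := by
  set N : Config → ℝ≥0∞ := fun ω => ω.1 B
  have hN : Measurable N := measurable_config_apply hB
  have hE : ∀ n : ℕ, MeasurableSet {ω | N ω = n} := fun n => hN (measurableSet_singleton _)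
  have hsum : ∑' n : ℕ, P {ω | N ω = n} = 1 := by
    simp_rw [N, hP.law B hB hIB]
    rw [← measure_univ (μ := poissonMeasure (I B).toNNReal),
      ← Measure.tsum_indicator_apply_singleton _ _ MeasurableSet.univ]
    simp
  have hdisj : Pairwise (Function.onFun Disjoint fun n : ℕ => {ω | N ω = n}) := by
    intro i j hij
    refine Set.disjoint_left.2 fun ω (hi : N ω = i) (hj : N ω = j) => hij ?_
    exact_mod_cast hi.symm.trans hj
  have hU : ∀ᵐ ω ∂P, ∃ n : ℕ, N ω = n := by
    have h1 : P (⋃ n : ℕ, {ω | N ω = n}) = 1 := by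
      rw [measure_iUnion hdisj hE, hsum]
    have := (prob_compl_eq_zero_iff (MeasurableSet.iUnion hE)).2 h1
    rw [ae_iff]
    convert this using 2
    ext ω
    simp
  have hae : ∀ᵐ ω ∂P, N ω = ∑' n : ℕ, {ω | N ω = n}.indicator (fun _ => (n : ℝ≥0∞)) ω := by
    filter_upwards [hU] with ω ⟨n, hn⟩
    rw [tsum_eq_single n]
    · have hmem : ω ∈ {ω | N ω = n} := hn
      rw [Set.indicator_of_mem hmem, hn]
    · intro k hk
      have hmem : ω ∉ {ω | N ω = k} := fun h => hk <| by
        exact_mod_cast (Set.mem_ofPred.1 h).symm.trans hn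
      exact Set.indicator_of_notMem hmem _
  rw [lintegral_congr_ae hae, lintegral_tsum fun n =>
    (measurable_const.indicator (hE n)).aemeasurable]
  simp_rw [fun n : ℕ => lintegral_indicator_const (μ := P) (hE n) (n : ℝ≥0∞), N,
    hP.law B hB hIB]
  rw [tsum_mul_poissonMeasure_singleton, ENNReal.coe_toNNReal hIB.ne]

/-- Two or more atoms in a set of measure `r` have probability of order `r ^ 2`. -/
theorem IsPoissonRandomMeasure.two_le_apply (hP : IsPoissonRandomMeasure P I) {B : Set Mark}
    (hB : MeasurableSet B) {r : ℝ≥0} (hIB : I B = r) : P {ω | 2 ≤ ω.1 B} ≤ (r ^ 2 : ℝ≥0) := by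
  have hN : Measurable fun ω : Config => ω.1 B := measurable_config_apply hB
  have hlaw : ∀ n : ℕ, P.real {ω | ω.1 B = n} = Real.exp (-r) * r ^ n / n.factorial := by
    intro n
    rw [measureReal_def, hP.law B hB (hIB ▸ ENNReal.coe_lt_top), ← measureReal_def,
      poissonMeasure_real_singleton, hIB, ENNReal.toNNReal_coe]
  have h0 : MeasurableSet {ω : Config | ω.1 B = (0 : ℕ)} := hN (measurableSet_singleton _)
  have h1 : MeasurableSet {ω : Config | ω.1 B = (1 : ℕ)} := hN (measurableSet_singleton _)
  have hd : Disjoint {ω : Config | ω.1 B = (0 : ℕ)} {ω : Config | ω.1 B = (1 : ℕ)} :=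
    Set.disjoint_left.2 fun ω (h : ω.1 B = (0 : ℕ)) (h' : ω.1 B = (1 : ℕ)) => by
      rw [h] at h'
      simp at h'
  have hsub : {ω : Config | 2 ≤ ω.1 B}
      ⊆ ({ω : Config | ω.1 B = (0 : ℕ)} ∪ {ω : Config | ω.1 B = (1 : ℕ)})ᶜ := by
    rintro ω (h : 2 ≤ ω.1 B) (h' | h')
    · rw [Set.mem_ofPred.1 h'] at h
      simp at h
    · rw [Set.mem_ofPred.1 h'] at h
      norm_num at h
  have hreal : P.real {ω | 2 ≤ ω.1 B} ≤ (r : ℝ) ^ 2 := by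
    have h2 := measureReal_mono (μ := P) hsub
    rw [probReal_compl_eq_one_sub (h0.union h1), measureReal_union hd h1, hlaw, hlaw] at h2
    have h3 := Real.add_one_le_exp (-(r : ℝ))
    have h4 : (0 : ℝ) ≤ r := r.2
    norm_num at h2
    nlinarith
  rw [← ENNReal.ofReal_coe_nnreal, ← ofReal_measureReal]
  exact ENNReal.ofReal_le_ofReal (by simpa using hreal)

/-- The past of the Poisson random measure is independent of a count in the future. For finitely
many sets in the past, the counts of the cells of the partition which they generate are
independent of the count in the future, and determine the counts of these sets. -/
theorem IsPoissonRandomMeasure.indep_history (hP : IsPoissonRandomMeasure P I) {a : ℝ≥0}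
    {C : Set Mark} (hC : MeasurableSet C) (hCa : C ⊆ {z | a < z.1}) :
    Indep (history a) (MeasurableSpace.comap (fun ω : Config => ω.1 C) inferInstance) P := by
  classical
  let ι := {p : Set ℝ≥0 × Set (ℝ≥0 × ℝ) //
    (MeasurableSet p.1 ∧ p.1 ⊆ Set.Iic a) ∧ MeasurableSet p.2}
  let R : ι → Set Mark := fun i => i.1.1 ×ˢ i.1.2
  have hR : ∀ i, MeasurableSet (R i) := fun i => i.2.1.1.prod i.2.2
  have hRa : ∀ i, ∀ z ∈ R i, z.1 ≤ a := fun i z hz => i.2.1.2 hz.1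
  let m : ι → MeasurableSpace Config := fun i =>
    MeasurableSpace.comap (fun ω : Config => ω.1 (R i)) inferInstance
  have hhist : (history a : MeasurableSpace Config) = ⨆ F : Finset ι, ⨆ i ∈ F, m i := by
    rw [← iSup_eq_iSup_finset]
    refine le_antisymm ?_ ?_
    · refine iSup_le fun T => iSup_le fun hT => iSup_le fun B => iSup_le fun hB => ?_
      exact le_iSup m ⟨(T, B), hT, hB⟩
    · exact iSup_le fun i => (measurable_history_rect i.2.1.1 i.2.1.2 i.2.2).comap_le
  have hm : ∀ i, m i ≤ (inferInstance : MeasurableSpace Config) := fun i =>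
    (measurable_config_apply (hR i)).comap_le
  rw [hhist]
  refine indep_iSup_of_directed_le (fun F => ?_) (fun F => iSup₂_le fun i _ => hm i)
    (measurable_config_apply hC).comap_le ?_
  · let Q : (F → Bool) → Set Mark := fun J => {z | z.1 ≤ a ∧ ∀ i : F, (z ∈ R i ↔ J i = true)}
    have hQ : ∀ J, MeasurableSet (Q J) := by
      intro J
      have : {z : Mark | ∀ i : F, (z ∈ R i ↔ J i = true)}
          = ⋂ i : F, {z | z ∈ R i ↔ J i = true} := by
        ext z
        simp
      have hset : MeasurableSet {z : Mark | ∀ i : F, (z ∈ R i ↔ J i = true)} := by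
        rw [this]
        exact MeasurableSet.iInter fun i => MeasurableSet.iff (hR i) (MeasurableSet.const _)
      exact (measurableSet_time_le a).inter hset
    let cell : Option (F → Bool) → Set Mark := fun o => o.elim C Q
    have hcell : ∀ o, MeasurableSet (cell o) := by
      rintro (_ | J)
      exacts [hC, hQ J]
    have hCQ : ∀ J, Disjoint C (Q J) := fun J =>
      Set.disjoint_left.2 fun z hz hz' => absurd hz'.1 (not_le.2 (hCa hz))
    have hdisj : ∀ o o', o ≠ o' → Disjoint (cell o) (cell o') := by
      rintro (_ | J) (_ | J') hne
      · exact absurd rfl hne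
      · exact hCQ J'
      · exact (hCQ J).symm
      · refine Set.disjoint_left.2 fun z hz hz' => hne ?_
        congr 1
        ext i
        rw [Bool.eq_iff_iff, ← hz.2 i, ← hz'.2 i]
    let e := Fintype.equivFin (Option (F → Bool))
    have hind : iIndepFun (fun o (ω : Config) => ω.1 (cell o)) P := by
      have h := (hP.indep _ (fun k => cell (e.symm k)) (fun k => hcell _)
        (fun k l hkl => hdisj _ _ fun h => hkl (e.symm.injective h))).precomp e.injective
      simpa using h
    have h := indep_iSup_of_disjoint
      (fun o => (measurable_config_apply (hcell o)).comap_le) hind.iIndep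
      (S := Set.range some) (T := {none}) (by simp)
    refine indep_of_indep_of_le h ?_ ?_
    · refine iSup₂_le fun i hi => ?_
      rw [← measurable_iff_comap_le]
      have hsum : ∀ ω : Config, ω.1 (R i)
          = ∑ J : F → Bool, if J ⟨i, hi⟩ = true then ω.1 (Q J) else 0 := by
        intro ω
        rw [← Finset.sum_filter, ← measure_biUnion_finset]
        · congr 1
          ext z
          simp only [Set.mem_iUnion, Finset.mem_filter, Finset.mem_univ, true_and]
          constructor
          · intro hz
            exact ⟨fun j => decide (z ∈ R j), by simpa using hz, hRa i z hz, by simp⟩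
          · rintro ⟨J, hJ, hz⟩
            exact (hz.2 ⟨i, hi⟩).2 hJ
        · intro J _ J' _ hne
          exact hdisj (some J) (some J') fun h => hne (Option.some_injective _ h)
        · exact fun J _ => hQ J
      simp_rw [hsum]
      refine Finset.measurable_fun_sum _ fun J _ => ?_
      split_ifs
      · rw [measurable_iff_comap_le]
        exact le_iSup₂_of_le (some J) ⟨J, rfl⟩ le_rfl
      · exact measurable_const
    · exact le_iSup₂_of_le none rfl le_rfl
  · refine directed_of_isDirected_le fun F G hFG => ?_
    exact biSup_mono fun i hi => hFG hi

theorem IsPoissonRandomMeasure.setLIntegral_apply (hP : IsPoissonRandomMeasure P I) {a : ℝ≥0}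
    {A : Set Config} (hA : MeasurableSet[history a] A) {C : Set Mark} (hC : MeasurableSet C)
    (hCa : C ⊆ {z | a < z.1}) (hIC : I C < ∞) : ∫⁻ ω in A, ω.1 C ∂P = P A * I C := by
  have hA' : MeasurableSet A := history.le a _ hA
  have hind := hP.indep_history hC hCa
  have h := lintegral_mul_indicator_eq_lintegral_mul_lintegral_indicator (μ := P)
    (f := fun ω : Config => ω.1 C) (measurable_config_apply hC).comap_le 1 hA' ?_
    (comap_measurable _)
  · rw [hP.lintegral_apply_of_lt_top hC hIC, lintegral_indicator_const hA', one_mul,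
      mul_comm (I C)] at h
    rw [← h, ← lintegral_indicator hA']
    refine lintegral_congr fun ω => ?_
    by_cases hω : ω ∈ A <;> simp [hω]
  · refine IndepSets.symm ?_
    have h2 := (Indep_iff _ _ _).1 hind
    rw [IndepSets_iff]
    rintro _ s rfl hs
    exact h2 _ _ hA hs

/-- The generating sets of the predictable σ-algebra. -/
def predGen : Set (Set PredSpace) :=
  {s | ∃ A, MeasurableSet[history ⊥] A ∧ s = {⊥} ×ˢ A} ∪
    {s | ∃ i A, MeasurableSet[history i] A ∧ s = Set.Ioi i ×ˢ A}

theorem isPiSystem_predGen : IsPiSystem predGen := by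
  rintro _ (⟨A, hA, rfl⟩ | ⟨i, A, hA, rfl⟩) _ (⟨B, hB, rfl⟩ | ⟨j, B, hB, rfl⟩) hne
  · refine Or.inl ⟨A ∩ B, hA.inter hB, ?_⟩
    exact (Set.prod_inter_prod).trans (by rw [Set.inter_self])
  · obtain ⟨x, hx, hx'⟩ := hne
    have h1 : (Prod.fst x : ℝ≥0) = ⊥ := hx.1
    have h2 : j < Prod.fst x := hx'.1
    exact absurd h2 (h1 ▸ not_lt_bot)
  · obtain ⟨x, hx', hx⟩ := hne
    have h1 : (Prod.fst x : ℝ≥0) = ⊥ := hx.1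
    have h2 : i < Prod.fst x := hx'.1
    exact absurd h2 (h1 ▸ not_lt_bot)
  · refine Or.inr ⟨i ⊔ j, A ∩ B, ?_, ?_⟩
    · exact (history.mono le_sup_left _ hA).inter (history.mono le_sup_right _ hB)
    · exact (Set.prod_inter_prod).trans (by rw [Set.Ioi_inter_Ioi])

theorem isCountablySpanning_predGen : IsCountablySpanning predGen := by
  refine ⟨fun n => if n = 0 then ({⊥} ×ˢ Set.univ : Set (ℝ≥0 × Config))
    else (Set.Ioi 0 ×ˢ Set.univ : Set (ℝ≥0 × Config)), fun n => ?_, ?_⟩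
  · dsimp only
    split_ifs with hn
    · exact Or.inl ⟨Set.univ, MeasurableSet.univ, if_pos hn⟩
    · exact Or.inr ⟨0, Set.univ, MeasurableSet.univ, if_neg hn⟩
  · refine Set.eq_univ_of_forall fun x => Set.mem_iUnion.2 ?_
    rcases eq_zero_or_pos (a := (Prod.fst x : ℝ≥0)) with h | h
    · exact ⟨0, h, trivial⟩
    · exact ⟨1, h, trivial⟩

theorem measurable_predPoint :
    Measurable fun x : Config × Mark => (PredSpace.mk x.2.1 x.1, x.2.2) :=
  (PredSpace.measurable_swap_mk.comp
    ((measurable_fst.comp measurable_snd).prodMk measurable_fst)).prodMk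
    (measurable_snd.comp measurable_snd)

theorem measurable_predSection {β : Type*} [MeasurableSpace β] {F : PredSpace × (ℝ≥0 × ℝ) → β}
    (hF : Measurable F) (ω : Config) : Measurable fun z : Mark => F (PredSpace.mk z.1 ω, z.2) :=
  hF.comp (measurable_predPoint.comp measurable_prodMk_left)

/-- The compensation formula: integrating a nonnegative predictable integrand against the Poisson
random measure or against its intensity gives the same mean. Both sides define measures on the
predictable space times the space of `(θ, y)`, which agree on predictable rectangles by
independence of the past. -/
theorem IsPoissonRandomMeasure.lintegral_lintegral
    (hP : IsPoissonRandomMeasure P (intensityMeasure ν))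
    {F : PredSpace × (ℝ≥0 × ℝ) → ℝ≥0∞} (hF : Measurable F) :
    ∫⁻ ω, ∫⁻ z, F (PredSpace.mk z.1 ω, z.2) ∂ω.1 ∂P
      = ∫⁻ ω, ∫⁻ z, F (PredSpace.mk z.1 ω, z.2) ∂(intensityMeasure ν) ∂P := by
  set g : Config × Mark → PredSpace × (ℝ≥0 × ℝ) := fun x => (PredSpace.mk x.2.1 x.1, x.2.2)
  have hg : Measurable g := measurable_predPoint
  set M₁ := (P ⊗ₘ configKernel).map g with hM₁
  set M₂ := (P.prod (intensityMeasure ν)).map g with hM₂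
  have key : M₁ = M₂ := by
    -- `W n` exhausts the space and has finite measure, so that a π-system determines the measures.
    set W : ℕ → Set (PredSpace × (ℝ≥0 × ℝ)) := fun n => {x | x.1.time ≤ n ∧ x.2.1 ≤ n}
    have hW : ∀ n, MeasurableSet (W n) := fun n =>
      (PredSpace.measurable_time.comp measurable_fst measurableSet_Iic).inter
        (measurable_fst.comp measurable_snd measurableSet_Iic)
    have hWU : ⋃ n, W n = Set.univ := by
      refine Set.eq_univ_of_forall fun x => ?_
      obtain ⟨n, hn⟩ := exists_nat_ge (max x.1.time x.2.1)
      exact Set.mem_iUnion.2 ⟨n, (le_max_left _ _).trans hn, (le_max_right _ _).trans hn⟩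
    have hbox : ∀ n : ℕ, intensityMeasure ν
        (Set.Iic (n : ℝ≥0) ×ˢ (Set.Iic (n : ℝ≥0) ×ˢ Set.univ)) < ∞ := by
      intro n
      rw [intensityMeasure_box, lebesgue_Iic]
      exact ENNReal.mul_lt_top ENNReal.coe_lt_top ENNReal.coe_lt_top
    have hrect₁ : ∀ (A : Set Config) (D : Set Mark), MeasurableSet A → MeasurableSet D →
        (P ⊗ₘ configKernel) (A ×ˢ D) = ∫⁻ ω in A, ω.1 D ∂P := fun A D hA hD =>
      Measure.compProd_apply_prod hA hD
    rw [Measure.ext_iff_of_iUnion_eq_univ hWU]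
    intro n
    have hbm : MeasurableSet
        (Set.Iic (n : ℝ≥0) ×ˢ (Set.Iic (n : ℝ≥0) ×ˢ (Set.univ : Set ℝ))) :=
      measurableSet_Iic.prod (measurableSet_Iic.prod MeasurableSet.univ)
    have hpre : g ⁻¹' (W n) = Set.univ ×ˢ
        (Set.Iic (n : ℝ≥0) ×ˢ (Set.Iic (n : ℝ≥0) ×ˢ (Set.univ : Set ℝ))) := by
      ext x
      simp [g, W]
    have hM₁W : M₁ (W n) = intensityMeasure ν
        (Set.Iic (n : ℝ≥0) ×ˢ (Set.Iic (n : ℝ≥0) ×ˢ Set.univ)) := by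
      rw [hM₁, Measure.map_apply hg (hW n), hpre, hrect₁ _ _ MeasurableSet.univ hbm,
        setLIntegral_univ, hP.lintegral_apply_of_lt_top hbm (hbox n)]
    have hM₂W : M₂ (W n) = intensityMeasure ν
        (Set.Iic (n : ℝ≥0) ×ˢ (Set.Iic (n : ℝ≥0) ×ˢ Set.univ)) := by
      rw [hM₂, Measure.map_apply hg (hW n), hpre, Measure.prod_prod, measure_univ, one_mul]
    have : IsFiniteMeasure (M₁.restrict (W n)) :=
      isFiniteMeasure_restrict.2 (hM₁W ▸ (hbox n).ne)
    refine ext_of_generate_finite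
      (Set.image2 (· ×ˢ ·) predGen {B : Set (ℝ≥0 × ℝ) | MeasurableSet B})
      (generateFrom_eq_prod rfl MeasurableSpace.generateFrom_measurableSet
        isCountablySpanning_predGen isCountablySpanning_measurableSet).symm
      (isPiSystem_predGen.prod MeasurableSpace.isPiSystem_measurableSet) ?_ ?_
    · rintro _ ⟨S, hS, B, hB : MeasurableSet B, rfl⟩
      have hSm : MeasurableSet S := MeasurableSpace.measurableSet_generateFrom hS
      rw [Measure.restrict_apply (hSm.prod hB), Measure.restrict_apply (hSm.prod hB), hM₁, hM₂,
        Measure.map_apply hg ((hSm.prod hB).inter (hW n)),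
        Measure.map_apply hg ((hSm.prod hB).inter (hW n))]
      have hpre' : ∀ (T : Set ℝ≥0) (A : Set Config),
          g ⁻¹' ((show Set PredSpace from (T ×ˢ A : Set (ℝ≥0 × Config))) ×ˢ B ∩ W n) = A ×ˢ
          ((T ∩ Set.Iic (n : ℝ≥0)) ×ˢ (B ∩ Set.Iic (n : ℝ≥0) ×ˢ (Set.univ : Set ℝ))) := by
        intro T A
        ext x
        constructor
        · rintro ⟨⟨⟨h1, h2⟩, h3⟩, h4, h5⟩
          exact ⟨h2, ⟨h1, h4⟩, h3, h5, trivial⟩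
        · rintro ⟨h2, ⟨h1, h4⟩, h3, h5, -⟩
          exact ⟨⟨⟨h1, h2⟩, h3⟩, h4, h5⟩
      have hBn : MeasurableSet (B ∩ Set.Iic (n : ℝ≥0) ×ˢ (Set.univ : Set ℝ)) :=
        hB.inter (measurableSet_Iic.prod MeasurableSet.univ)
      rcases hS with ⟨A, hA, rfl⟩ | ⟨a, A, hA, rfl⟩
      · -- The atoms at time zero form a null set for both measures.
        have hD := ((measurableSet_singleton (⊥ : ℝ≥0)).inter
          (measurableSet_Iic (a := (n : ℝ≥0)))).prod hBn
        have hI0 : intensityMeasure ν (({⊥} ∩ Set.Iic (n : ℝ≥0)) ×ˢ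
            (B ∩ Set.Iic (n : ℝ≥0) ×ˢ (Set.univ : Set ℝ))) = 0 :=
          measure_mono_null (fun z hz => hz.1.1) (intensityMeasure_time_eq ν ⊥)
        have hA' : MeasurableSet A := history.le _ _ hA
        have h1 := hpre' {⊥} A
        dsimp only at h1
        erw [h1]
        rw [hrect₁ _ _ hA' hD, Measure.prod_prod, hI0, mul_zero]
        refine le_antisymm ((setLIntegral_le_lintegral _ _).trans ?_) zero_le
        rw [hP.lintegral_apply_of_lt_top hD (hI0 ▸ ENNReal.zero_lt_top), hI0]
      · have hD := ((measurableSet_Ioi (a := a)).inter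
          (measurableSet_Iic (a := (n : ℝ≥0)))).prod hBn
        have hA' : MeasurableSet A := history.le _ _ hA
        have h1 := hpre' (Set.Ioi a) A
        dsimp only at h1
        erw [h1]
        rw [hrect₁ _ _ hA' hD, Measure.prod_prod]
        refine hP.setLIntegral_apply hA hD (fun z hz => hz.1.1) ?_
        refine (measure_mono ?_).trans_lt (hbox n)
        exact Set.prod_mono Set.inter_subset_right Set.inter_subset_right
    · rw [Measure.restrict_apply_univ, Measure.restrict_apply_univ, hM₁W, hM₂W]
  have e₁ : ∫⁻ x, F x ∂M₁ = ∫⁻ ω, ∫⁻ z, F (PredSpace.mk z.1 ω, z.2) ∂ω.1 ∂P := by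
    rw [hM₁, lintegral_map hF hg]
    exact Measure.lintegral_compProd (hF.comp hg)
  have e₂ : ∫⁻ x, F x ∂M₂
      = ∫⁻ ω, ∫⁻ z, F (PredSpace.mk z.1 ω, z.2) ∂(intensityMeasure ν) ∂P := by
    rw [hM₂, lintegral_map hF hg]
    exact lintegral_prod _ (hF.comp hg).aemeasurable
  rw [← e₁, ← e₂, key]

/-- Almost surely no atom lies on the graph of a predictable process. -/
theorem IsPoissonRandomMeasure.ae_ne_predictable
    (hP : IsPoissonRandomMeasure P (intensityMeasure ν)) {ℓ : PredSpace → ℝ≥0∞}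
    (hℓ : Measurable ℓ) : ∀ᵐ ω ∂P, ∀ z ∈ atoms ω, ℓ (PredSpace.mk z.1 ω) ≠ z.2.1 := by
  classical
  have hS : MeasurableSet {x : PredSpace × (ℝ≥0 × ℝ) | ℓ x.1 = (x.2.1 : ℝ≥0∞)} :=
    measurableSet_eq_fun (hℓ.comp measurable_fst)
      (measurable_fst.comp measurable_snd).coe_nnreal_ennreal
  set F : PredSpace × (ℝ≥0 × ℝ) → ℝ≥0∞ :=
    {x : PredSpace × (ℝ≥0 × ℝ) | ℓ x.1 = (x.2.1 : ℝ≥0∞)}.indicator 1 with hFdef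
  have hF : Measurable F := measurable_one.indicator hS
  have h := hP.lintegral_lintegral hF
  have h0 : ∀ ω : Config, ∫⁻ z, F (PredSpace.mk z.1 ω, z.2) ∂(intensityMeasure ν) = 0 := by
    intro ω
    rw [lintegral_intensityMeasure ν (measurable_predSection hF ω)]
    refine (lintegral_congr fun u => ?_).trans lintegral_zero
    have h1 : ∀ᵐ θ ∂lebesgue, θ ≠ (ℓ (PredSpace.mk u ω)).toNNReal := by
      rw [ae_iff]
      simpa using lebesgue_singleton _
    refine (lintegral_congr_ae ?_).trans lintegral_zero
    filter_upwards [h1] with θ hθ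
    refine (lintegral_congr fun y => ?_).trans lintegral_zero
    refine Set.indicator_of_notMem (fun hx => hθ ?_) _
    have hx' : ℓ (PredSpace.mk u ω) = (θ : ℝ≥0∞) := hx
    rw [hx', ENNReal.toNNReal_coe]
  simp_rw [h0, lintegral_zero] at h
  have hmeas : Measurable fun ω : Config => ∫⁻ z, F (PredSpace.mk z.1 ω, z.2) ∂ω.1 :=
    (hF.comp measurable_predPoint).lintegral_kernel_prod_right' (κ := configKernel)
  rw [lintegral_eq_zero_iff hmeas] at h
  filter_upwards [h] with ω hω z hz hzℓ
  have hω' : ∫⁻ z, F (PredSpace.mk z.1 ω, z.2) ∂ω.1 = 0 := hω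
  rw [lintegral_eq_zero_iff (measurable_predSection hF ω)] at hω'
  have h2 := (ae_config_iff ω _).1 hω' z hz
  simp only [hFdef, Pi.zero_apply, Set.indicator_apply_eq_zero, Pi.one_apply, one_ne_zero] at h2
  exact h2 hzℓ

theorem IsPoissonRandomMeasure.ae_time_ne (hP : IsPoissonRandomMeasure P (intensityMeasure ν))
    (t : ℝ≥0) : ∀ᵐ ω ∂P, ∀ z ∈ atoms ω, z.1 ≠ t := by
  have hm : MeasurableSet {z : Mark | z.1 = t} := measurable_fst (measurableSet_singleton t)
  have h0 := intensityMeasure_time_eq ν t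
  have h := hP.lintegral_apply_of_lt_top hm (h0 ▸ ENNReal.zero_lt_top)
  rw [h0, lintegral_eq_zero_iff (measurable_config_apply hm)] at h
  filter_upwards [h] with ω hω z hz hzt
  have h1 : ω.1 {z | z.1 = t} = 0 := hω
  rw [config_apply_eq_encard, ENat.toENNReal_eq_zero, Set.encard_eq_zero] at h1
  exact Set.eq_empty_iff_forall_notMem.1 h1 z ⟨hz, hzt⟩

/-- Almost surely no two atoms occur at the same time: cutting time into `n` intervals per unit,
one of them would contain two atoms, which has a probability of order `1 / n`. -/
theorem IsPoissonRandomMeasure.ae_simple (hP : IsPoissonRandomMeasure P (intensityMeasure ν)) :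
    ∀ᵐ ω ∂P, ∀ z ∈ atoms ω, ∀ z' ∈ atoms ω, z.1 = z'.1 → z = z' := by
  have hb : ∀ b : ℕ, ∀ᵐ ω ∂P, ∀ z ∈ atoms ω, ∀ z' ∈ atoms ω, z.1 < b → z.2.1 ≤ b → z'.2.1 ≤ b →
      z.1 = z'.1 → z = z' := by
    intro b
    set E : Set Config := {ω | ¬ ∀ z ∈ atoms ω, ∀ z' ∈ atoms ω, z.1 < b → z.2.1 ≤ b → z'.2.1 ≤ b →
      z.1 = z'.1 → z = z'}
    have hE : ∀ n : ℕ, P E ≤ ((b ^ 3 / (n + 1) : ℝ≥0) : ℝ≥0∞) := by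
      intro n
      set c : ℝ≥0 := n + 1
      have hc : 0 < c := by positivity
      set S : ℕ → Set Mark := fun k =>
        Set.Ico ((k : ℝ≥0) / c) ((k + 1 : ℝ≥0) / c) ×ˢ (Set.Iic (b : ℝ≥0) ×ˢ Set.univ)
      have hS : ∀ k, MeasurableSet (S k) := fun k =>
        measurableSet_Ico.prod (measurableSet_Iic.prod MeasurableSet.univ)
      have hIS : ∀ k, intensityMeasure ν (S k) = ((b / c : ℝ≥0) : ℝ≥0∞) := by
        intro k
        rw [intensityMeasure_box, lebesgue_Ico, lebesgue_Iic, ← ENNReal.coe_sub, ← ENNReal.coe_mul,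
          ← NNReal.sub_div]
        congr 1
        rw [add_tsub_cancel_left]
        ring
      have hsub : E ⊆ ⋃ k ∈ Finset.range (b * (n + 1)), {ω : Config | 2 ≤ ω.1 (S k)} := by
        intro ω hω
        simp only [E, Set.mem_ofPred_eq, not_forall] at hω
        obtain ⟨z, hz, z', hz', h1, h2, h3, h4, hne⟩ := hω
        have hk1 : ((⌊z.1 * c⌋₊ : ℕ) : ℝ≥0) ≤ z.1 * c := Nat.floor_le zero_le
        have hk2 : z.1 * c < (⌊z.1 * c⌋₊ : ℝ≥0) + 1 := Nat.lt_floor_add_one _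
        refine Set.mem_iUnion₂.2 ⟨⌊z.1 * c⌋₊, ?_, ?_⟩
        · rw [Finset.mem_range, Nat.floor_lt zero_le]
          push_cast
          exact mul_lt_mul_of_pos_right h1 hc
        · have hmem : ∀ w : Mark, w.1 = z.1 → w.2.1 ≤ b → w ∈ S ⌊z.1 * c⌋₊ := fun w hw hwb =>
            ⟨⟨by rwa [hw, div_le_iff₀ hc], by rwa [hw, lt_div_iff₀ hc]⟩, hwb, trivial⟩
          rw [Set.mem_ofPred_eq, config_apply_eq_encard]
          have h5 : ({z, z'} : Set Mark) ⊆ atoms ω ∩ S ⌊z.1 * c⌋₊ := by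
            rintro w (rfl | rfl)
            exacts [⟨hz, hmem _ rfl h2⟩, ⟨hz', hmem _ h4.symm h3⟩]
          have h6 := Set.encard_le_encard h5
          rw [Set.encard_pair hne] at h6
          exact_mod_cast ENat.toENNReal_le.2 h6
      refine (measure_mono hsub).trans ((measure_biUnion_finset_le _ _).trans ?_)
      refine (Finset.sum_le_sum fun k _ => hP.two_le_apply (hS k) (hIS k)).trans ?_
      rw [Finset.sum_const, Finset.card_range, nsmul_eq_mul]
      have hcc : (n : ℝ≥0) + 1 = c := rfl
      have : ((b * (n + 1) : ℕ) : ℝ≥0) * (b / c) ^ 2 = b ^ 3 / (n + 1) := by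
        push_cast
        rw [hcc]
        field_simp
      rw [← this]
      push_cast
      rfl
    rw [ae_iff]
    refine le_antisymm (ge_of_tendsto' (x := Filter.atTop) ?_ hE) zero_le
    rw [← ENNReal.coe_zero, ENNReal.tendsto_coe]
    have h1 : Filter.Tendsto (fun n : ℕ => (b : ℝ≥0) ^ 3 * (1 / ((n : ℝ≥0) + 1))) Filter.atTop
        (nhds ((b : ℝ≥0) ^ 3 * 0)) :=
      tendsto_one_div_add_atTop_nhds_zero_nat.const_mul _
    simpa [div_eq_mul_inv] using h1
  filter_upwards [ae_all_iff.2 hb] with ω hω z hz z' hz' heq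
  obtain ⟨b, hb⟩ := exists_nat_gt (max z.1 (max z.2.1 z'.2.1))
  exact hω b z hz z' hz' ((le_max_left _ _).trans_lt hb)
    (((le_max_left _ _).trans (le_max_right _ _)).trans hb.le)
    (((le_max_right _ _).trans (le_max_right _ _)).trans hb.le) heq

end Poisson

/-! ### Picard iteration for the thinning equation -/

/-- The points of the predictable space times the marks that lie after time `v` in the region
`L ≤ θ < L + ℓ`. The upper boundary is excluded, unlike in `kept`, so that the region passes to
increasing limits of `ℓ`. -/
def region (L : PredSpace → ℝ≥0) (v : ℝ≥0) (ℓ : PredSpace → ℝ≥0∞) :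
    Set (PredSpace × (ℝ≥0 × ℝ)) :=
  {x | v < x.1.time ∧ L x.1 ≤ x.2.1 ∧ (x.2.1 : ℝ≥0∞) < L x.1 + ℓ x.1}

/-- One step of the Picard iteration, on `[0, ∞]`-valued intensities. -/
def picardStep (m Φ : ℝ≥0 → ℝ≥0) (L : PredSpace → ℝ≥0) (v : ℝ≥0) (ℓ : PredSpace → ℝ≥0∞)
    (p : PredSpace) : ℝ≥0∞ :=
  m p.time + ∫⁻ z in {z | z.1 < p.time}, (region L v ℓ).indicator
    (fun x => (Φ (p.time - x.1.time) : ℝ≥0∞)) (PredSpace.mk z.1 p.config, z.2) ∂p.config.1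

/-- The Picard iterates of the intensity. -/
def picard (m Φ : ℝ≥0 → ℝ≥0) (L : PredSpace → ℝ≥0) (v : ℝ≥0) : ℕ → PredSpace → ℝ≥0∞
  | 0 => 0
  | n + 1 => picardStep m Φ L v (picard m Φ L v n)

/-- The limit of the increasing sequence of Picard iterates. -/
def picardLimit (m Φ : ℝ≥0 → ℝ≥0) (L : PredSpace → ℝ≥0) (v : ℝ≥0) (p : PredSpace) : ℝ≥0∞ :=
  ⨆ n, picard m Φ L v n p

/-- The sum of `f(y)` over the atoms `(u, θ, y)` up to time `s` that are kept by the limit of the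
Picard iteration. -/
def picardSum (m Φ : ℝ≥0 → ℝ≥0) (L : PredSpace → ℝ≥0) (v : ℝ≥0) (f : ℝ → ℝ) (s : ℝ≥0)
    (ω : Config) : ℝ :=
  ∫ z in {z | z.1 ≤ s}, (region L v (picardLimit m Φ L v)).indicator (fun x => f x.2.2)
    (PredSpace.mk z.1 ω, z.2) ∂ω.1

section Picard

variable {m Φ : ℝ≥0 → ℝ≥0} {L : PredSpace → ℝ≥0} {v : ℝ≥0}

theorem measurableSet_region {ℓ : PredSpace → ℝ≥0∞} (hL : Measurable L) (hℓ : Measurable ℓ) :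
    MeasurableSet (region L v ℓ) := by
  have hθ : Measurable fun x : PredSpace × (ℝ≥0 × ℝ) => x.2.1 :=
    measurable_fst.comp measurable_snd
  refine (measurableSet_lt measurable_const (PredSpace.measurable_time.comp measurable_fst)).inter
    ((measurableSet_le (hL.comp measurable_fst) hθ).inter ?_)
  exact measurableSet_lt hθ.coe_nnreal_ennreal
    ((hL.comp measurable_fst).coe_nnreal_ennreal.add (hℓ.comp measurable_fst))

theorem region_mono {ℓ ℓ' : PredSpace → ℝ≥0∞} (h : ℓ ≤ ℓ') : region L v ℓ ⊆ region L v ℓ' :=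
  fun x hx => ⟨hx.1, hx.2.1, hx.2.2.trans_le (add_le_add le_rfl (h x.1))⟩

theorem measurable_picardStep {ℓ : PredSpace → ℝ≥0∞} (hm : Measurable m) (hΦ : Measurable Φ)
    (hL : Measurable L) (hℓ : Measurable ℓ) : Measurable (picardStep m Φ L v ℓ) := by
  refine (hm.comp PredSpace.measurable_time).coe_nnreal_ennreal.add ?_
  have hF : Measurable fun x : PredSpace × (PredSpace × (ℝ≥0 × ℝ)) => (region L v ℓ).indicator
      (fun y => (Φ (x.1.time - y.1.time) : ℝ≥0∞)) x.2 := by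
    have h1 : Measurable fun x : PredSpace × (PredSpace × (ℝ≥0 × ℝ)) =>
        (Φ (x.1.time - x.2.1.time) : ℝ≥0∞) :=
      (hΦ.comp ((PredSpace.measurable_time.comp measurable_fst).sub
        (PredSpace.measurable_time.comp
          (measurable_fst.comp measurable_snd)))).coe_nnreal_ennreal
    exact h1.indicator (measurable_snd (measurableSet_region (v := v) hL hℓ))
  exact measurable_predIntegral hF

theorem measurable_picard (hm : Measurable m) (hΦ : Measurable Φ) (hL : Measurable L) (n : ℕ) :
    Measurable (picard m Φ L v n) := by
  induction n with
  | zero => exact measurable_zero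
  | succ n ih => exact measurable_picardStep hm hΦ hL ih

theorem measurable_picardLimit (hm : Measurable m) (hΦ : Measurable Φ) (hL : Measurable L) :
    Measurable (picardLimit m Φ L v) :=
  Measurable.iSup fun n => measurable_picard hm hΦ hL n

theorem picardStep_mono {ℓ ℓ' : PredSpace → ℝ≥0∞} (h : ℓ ≤ ℓ') :
    picardStep m Φ L v ℓ ≤ picardStep m Φ L v ℓ' := fun _ =>
  add_le_add le_rfl (lintegral_mono fun _ =>
    Set.indicator_le_indicator_of_subset (region_mono h) (fun _ => zero_le) _)

theorem picard_mono : Monotone (picard m Φ L v) := by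
  refine monotone_nat_of_le_succ fun n => ?_
  induction n with
  | zero => exact fun p => zero_le
  | succ n ih => exact picardStep_mono ih

/-- Since the upper boundary of the region is excluded, the regions of the iterates exhaust the
region of the limit, whether or not the limit is finite. -/
theorem region_picardLimit :
    region L v (picardLimit m Φ L v) = ⋃ n, region L v (picard m Φ L v n) := by
  ext x
  simp only [region, picardLimit, Set.mem_iUnion, Set.mem_ofPred_eq, ENNReal.add_iSup,
    lt_iSup_iff]
  constructor
  · rintro ⟨h1, h2, n, hn⟩
    exact ⟨n, h1, h2, hn⟩
  · rintro ⟨n, h1, h2, hn⟩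
    exact ⟨h1, h2, n, hn⟩

theorem picardLimit_eq (hm : Measurable m) (hΦ : Measurable Φ) (hL : Measurable L)
    (p : PredSpace) : picardLimit m Φ L v p = picardStep m Φ L v (picardLimit m Φ L v) p := by
  have h1 : picardLimit m Φ L v p = ⨆ n, picard m Φ L v (n + 1) p :=
    (Monotone.iSup_nat_add (f := fun n => picard m Φ L v n p)
      (fun i j hij => picard_mono hij p) 1).symm
  rw [h1, picardStep, region_picardLimit]
  simp_rw [Set.indicator_iUnion_apply (bot_eq_zero (α := ℝ≥0∞))]
  rw [lintegral_iSup, ENNReal.add_iSup]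
  · rfl
  · intro n
    have h2 : Measurable fun x : PredSpace × (ℝ≥0 × ℝ) =>
        (region L v (picard m Φ L v n)).indicator
          (fun y => (Φ (p.time - y.1.time) : ℝ≥0∞)) x :=
      ((hΦ.comp (measurable_const.sub
        (PredSpace.measurable_time.comp measurable_fst))).coe_nnreal_ennreal).indicator
        (measurableSet_region hL (measurable_picard hm hΦ hL n))
    exact measurable_predSection h2 p.config
  · intro i j hij z
    exact Set.indicator_le_indicator_of_subset (region_mono (picard_mono hij)) (fun _ => zero_le) _

/-- Where the limit of the Picard iteration keeps only finitely many atoms in bounded time, and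
none on the upper boundary of its region, it solves the thinning equation. -/
theorem solvesThinning_picard (hm : Measurable m) (hΦ : Measurable Φ) (hL : Measurable L)
    {ω : Config}
    (hfin : ∀ T : ℝ≥0, ω.1 {z | z.1 ≤ T ∧
      (PredSpace.mk z.1 ω, z.2) ∈ region L v (picardLimit m Φ L v)} < ∞)
    (hne : ∀ z ∈ atoms ω, (L (PredSpace.mk z.1 ω) : ℝ≥0∞) + picardLimit m Φ L v (PredSpace.mk z.1 ω)
      ≠ z.2.1) :
    (∀ s, picardLimit m Φ L v (PredSpace.mk s ω) < ∞) ∧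
    SolvesThinning (fun s => m s) Φ (fun s => L (PredSpace.mk s ω)) v ω
      (fun s => picardSum m Φ L v id s ω) (fun s => picardSum m Φ L v (fun _ => 1) s ω)
      (fun s => (picardLimit m Φ L v (PredSpace.mk s ω)).toReal) := by
  set Λ := picardLimit m Φ L v with hΛ
  set A : Set Mark := {z | z ∈ atoms ω ∧ (PredSpace.mk z.1 ω, z.2) ∈ region L v Λ} with hA
  have hAle : ∀ s, (A ∩ {z | z.1 ≤ s}).Finite := fun s =>
    ((config_apply_lt_top_iff ω _).1 (hfin s)).subset fun z hz => ⟨hz.1.1, hz.2, hz.1.2⟩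
  have hAlt : ∀ s, (A ∩ {z | z.1 < s}).Finite := fun s =>
    (hAle s).subset (Set.inter_subset_inter_right _ fun z hz => le_of_lt (Set.mem_ofPred.1 hz))
  have hΛeq : ∀ s, Λ (PredSpace.mk s ω)
      = m s + ENNReal.ofReal (∑ᶠ z ∈ A ∩ {z | z.1 < s}, (Φ (s - z.1) : ℝ)) := by
    intro s
    rw [hΛ, picardLimit_eq hm hΦ hL, picardStep, PredSpace.time_mk, PredSpace.config_mk, ← hΛ,
      ← lintegral_indicator (measurableSet_time_lt s)]
    congr 1
    classical
    have h1 := config_lintegral (ω := ω) (fun z => if z ∈ A ∩ {z | z.1 < s} then Φ (s - z.1) else 0)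
      (hAlt s) (fun z hz => hz.1.1) (fun z _ hz => if_neg hz)
    rw [finsum_mem_congr rfl (g := fun z => (Φ (s - z.1) : ℝ))] at h1
    · rw [← h1]
      refine lintegral_congr_ae ((ae_config_iff ω _).2 fun z hz => ?_)
      have hz' : z ∈ A ∩ {z | z.1 < s} ↔ z ∈ {z : Mark | z.1 < s} ∧
          (PredSpace.mk z.1 ω, z.2) ∈ region L v Λ :=
        ⟨fun h => ⟨h.2, h.1.2⟩, fun h => ⟨⟨hz, h.2⟩, h.1⟩⟩
      simp only [Set.indicator_apply, hz', PredSpace.time_mk]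
      by_cases h1 : z ∈ {z : Mark | z.1 < s} <;>
        by_cases h2 : (PredSpace.mk z.1 ω, z.2) ∈ region L v Λ <;>
        simp only [h1, h2, and_true, and_false, if_true, if_false, ENNReal.coe_zero]
    · intro z hz
      rw [if_pos hz]
  have hΛfin : ∀ s, Λ (PredSpace.mk s ω) < ∞ := fun s => by
    rw [hΛeq s]
    exact ENNReal.add_lt_top.2 ⟨ENNReal.coe_lt_top, ENNReal.ofReal_lt_top⟩
  refine ⟨hΛfin, ?_⟩
  have hkept : kept v (fun s => L (PredSpace.mk s ω)) (fun s => (Λ (PredSpace.mk s ω)).toReal) ω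
      = A := by
    ext z
    simp only [kept, hA, region, Set.mem_ofPred_eq, PredSpace.time_mk]
    refine and_congr_right fun hz => and_congr_right fun _ => and_congr ?_ ?_
    · exact NNReal.coe_le_coe
    · have h2 := hne z hz
      lift Λ (PredSpace.mk z.1 ω) to ℝ≥0 using (hΛfin z.1).ne with r
      rw [ENNReal.coe_toReal]
      have h3 : L (PredSpace.mk z.1 ω) + r ≠ z.2.1 := by exact_mod_cast h2
      rw [← ENNReal.coe_add, ENNReal.coe_lt_coe, ← NNReal.coe_add, NNReal.coe_le_coe]
      exact ⟨fun h => lt_of_le_of_ne h h3.symm, le_of_lt⟩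
  have hsum : ∀ (f : ℝ → ℝ) (s : ℝ≥0),
      picardSum m Φ L v f s ω = ∑ᶠ z ∈ A ∩ {z | z.1 ≤ s}, f z.2.2 := by
    intro f s
    rw [picardSum, ← integral_indicator (measurableSet_time_le s), ← hΛ,
      config_integral _ (hAle s) (fun z hz => hz.1.1)]
    · refine finsum_mem_congr rfl fun z hz => ?_
      rw [Set.indicator_of_mem hz.2, Set.indicator_of_mem hz.1.2]
    · intro z hz hzA
      by_cases hzs : z ∈ {z : Mark | z.1 ≤ s}
      · rw [Set.indicator_of_mem hzs, Set.indicator_of_notMem fun h => hzA ⟨⟨hz, h⟩, hzs⟩]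
      · rw [Set.indicator_of_notMem hzs]
  refine ⟨fun s => ?_, fun s _ => ?_, fun s _ => ?_, fun s _ => ?_⟩
  · rw [hkept]
    exact hAle s
  · rw [hkept]
    exact hsum (fun _ => 1) s
  · rw [hkept]
    exact hsum id s
  · rw [hkept, hΛeq s, ENNReal.toReal_add ENNReal.coe_ne_top ENNReal.ofReal_ne_top,
      ENNReal.coe_toReal, ENNReal.toReal_ofReal]
    exact finsum_nonneg fun _ => finsum_nonneg fun _ => NNReal.coe_nonneg _

theorem measurable_picardSum (hm : Measurable m) (hΦ : Measurable Φ) (hL : Measurable L)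
    {f : ℝ → ℝ} (hf : Measurable f) (s : ℝ≥0) :
    Measurable[history s] (picardSum m Φ L v f s) := by
  have hF : Measurable ((region L v (picardLimit m Φ L v)).indicator
      fun x : PredSpace × (ℝ≥0 × ℝ) => f x.2.2) :=
    (hf.comp (measurable_snd.comp measurable_snd)).indicator
      (measurableSet_region hL (measurable_picardLimit hm hΦ hL))
  exact measurable_histIntegral s hF

end Picard

/-! ### Moments of the Picard iteration -/

theorem lebesgue_region (a : ℝ≥0) (r : ℝ≥0∞) :
    lebesgue {θ | a ≤ θ ∧ (θ : ℝ≥0∞) < a + r} = r := by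
  rcases eq_or_ne r ∞ with rfl | hr
  · have : {θ : ℝ≥0 | a ≤ θ ∧ (θ : ℝ≥0∞) < a + ∞} = Set.Ici a := by
      ext θ
      simp
    rw [this, lebesgue_apply measurableSet_Ici, NNReal.image_coe_Ici, Real.volume_Ici]
  · lift r to ℝ≥0 using hr
    have : {θ : ℝ≥0 | a ≤ θ ∧ (θ : ℝ≥0∞) < a + r} = Set.Ico a (a + r) := by
      ext θ
      exact and_congr_right fun _ => by rw [← ENNReal.coe_add, ENNReal.coe_lt_coe]
    rw [this, lebesgue_Ico, ← ENNReal.coe_sub, add_tsub_cancel_left]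

section Moments

variable {ν : Measure ℝ} [IsProbabilityMeasure ν] {P : Measure Config} [IsProbabilityMeasure P]
  {m Φ : ℝ≥0 → ℝ≥0} {L : PredSpace → ℝ≥0} {v : ℝ≥0}

theorem measurable_pred_time_section {ℓ : PredSpace → ℝ≥0∞} (hℓ : Measurable ℓ) (ω : Config) :
    Measurable fun u => ℓ (PredSpace.mk u ω) :=
  hℓ.comp (PredSpace.measurable_swap_mk.comp (measurable_id.prodMk measurable_const))

theorem measurable_pred_config_section {ℓ : PredSpace → ℝ≥0∞} (hℓ : Measurable ℓ) (u : ℝ≥0) :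
    Measurable fun ω => ℓ (PredSpace.mk u ω) :=
  hℓ.comp (PredSpace.measurable_swap_mk.comp (measurable_const.prodMk measurable_id))

/-- The compensation formula for the atoms of a region: they arrive at rate `ℓ`. -/
theorem IsPoissonRandomMeasure.lintegral_region
    (hP : IsPoissonRandomMeasure P (intensityMeasure ν)) {ℓ g : PredSpace → ℝ≥0∞}
    (hL : Measurable L) (hℓ : Measurable ℓ) (hg : Measurable g) :
    ∫⁻ ω, ∫⁻ z, (region L v ℓ).indicator (fun x => g x.1) (PredSpace.mk z.1 ω, z.2) ∂ω.1 ∂P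
      = ∫⁻ ω, ∫⁻ u in Set.Ioi v,
        g (PredSpace.mk u ω) * ℓ (PredSpace.mk u ω) ∂lebesgue ∂P := by
  have hF : Measurable ((region L v ℓ).indicator fun x => g x.1) :=
    (hg.comp measurable_fst).indicator (measurableSet_region hL hℓ)
  rw [hP.lintegral_lintegral hF]
  refine lintegral_congr fun ω => ?_
  rw [lintegral_intensityMeasure ν (measurable_predSection hF ω),
    ← lintegral_indicator measurableSet_Ioi]
  refine lintegral_congr fun u => ?_
  by_cases hu : v < u
  · rw [Set.indicator_of_mem (show u ∈ Set.Ioi v from hu)]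
    have h1 : ∀ (θ : ℝ≥0) (y : ℝ), (region L v ℓ).indicator (fun x => g x.1)
        (PredSpace.mk u ω, (θ, y)) = {θ : ℝ≥0 | L (PredSpace.mk u ω) ≤ θ ∧
          (θ : ℝ≥0∞) < L (PredSpace.mk u ω) + ℓ (PredSpace.mk u ω)}.indicator
            (fun _ => g (PredSpace.mk u ω)) θ := by
      intro θ y
      have h : (PredSpace.mk u ω, (θ, y)) ∈ region L v ℓ ↔ θ ∈ {θ : ℝ≥0 | L (PredSpace.mk u ω) ≤ θ ∧
          (θ : ℝ≥0∞) < L (PredSpace.mk u ω) + ℓ (PredSpace.mk u ω)} :=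
        ⟨fun h => h.2, fun h => ⟨hu, h⟩⟩
      classical
      simp only [Set.indicator_apply, h]
    simp_rw [h1, lintegral_const, measure_univ, mul_one]
    rw [lintegral_indicator_const, lebesgue_region]
    exact measurableSet_Ici.inter (measurableSet_lt measurable_coe_nnreal_ennreal measurable_const)
  · rw [Set.indicator_of_notMem (show u ∉ Set.Ioi v from hu)]
    refine (lintegral_congr fun θ => ?_).trans lintegral_zero
    refine (lintegral_congr fun y => ?_).trans lintegral_zero
    exact Set.indicator_of_notMem (fun h => hu h.1) _

/-- The mean of `ℓ`, integrated over `(v, T]`. -/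
def meanIntensity (P : Measure Config) (v T : ℝ≥0) (ℓ : PredSpace → ℝ≥0∞) : ℝ≥0∞ :=
  ∫⁻ ω, ∫⁻ u in Set.Ioc v T, ℓ (PredSpace.mk u ω) ∂lebesgue ∂P

theorem meanIntensity_swap {ℓ : PredSpace → ℝ≥0∞} (hℓ : Measurable ℓ) (T : ℝ≥0) :
    meanIntensity P v T ℓ
      = ∫⁻ u in Set.Ioc v T, ∫⁻ ω, ℓ (PredSpace.mk u ω) ∂P ∂lebesgue := by
  rw [meanIntensity, lintegral_lintegral_swap]
  exact (hℓ.comp (PredSpace.measurable_swap_mk.comp measurable_swap)).aemeasurable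

theorem IsPoissonRandomMeasure.lintegral_picardStep
    (hP : IsPoissonRandomMeasure P (intensityMeasure ν)) {ℓ : PredSpace → ℝ≥0∞}
    (hΦ : Measurable Φ) (hL : Measurable L) (hℓ : Measurable ℓ) (s : ℝ≥0) :
    ∫⁻ ω, picardStep m Φ L v ℓ (PredSpace.mk s ω) ∂P = m s + ∫⁻ ω, ∫⁻ u in Set.Ioi v,
      (Set.Iio s).indicator (fun u => (Φ (s - u) : ℝ≥0∞)) u * ℓ (PredSpace.mk u ω)
        ∂lebesgue ∂P := by
  have hg : Measurable fun p : PredSpace =>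
      (Set.Iio s).indicator (fun u => (Φ (s - u) : ℝ≥0∞)) p.time :=
    ((hΦ.comp (measurable_const.sub measurable_id)).coe_nnreal_ennreal.indicator
      measurableSet_Iio).comp PredSpace.measurable_time
  have h := hP.lintegral_region (v := v) hL hℓ hg
  simp only [PredSpace.time_mk] at h
  rw [← h]
  simp only [picardStep, PredSpace.time_mk, PredSpace.config_mk]
  rw [lintegral_add_left measurable_const, lintegral_const, measure_univ, mul_one]
  congr 1
  refine lintegral_congr fun ω => ?_
  rw [← lintegral_indicator (measurableSet_time_lt s)]
  refine lintegral_congr fun z => ?_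
  classical
  have h1 : z ∈ {z : Mark | z.1 < s} ↔ z.1 ∈ Set.Iio s := Iff.rfl
  simp only [Set.indicator_apply, PredSpace.time_mk, h1]
  by_cases h2 : z.1 ∈ Set.Iio s <;> simp only [h2, if_true, if_false, ite_self]

/-- A Picard step adds the mean of the base intensity, and multiplies the mean of the previous
intensity by at most the total mass of the kernel. -/
theorem IsPoissonRandomMeasure.meanIntensity_picardStep_le
    (hP : IsPoissonRandomMeasure P (intensityMeasure ν)) {ℓ : PredSpace → ℝ≥0∞}
    (hm : Measurable m) (hΦ : Measurable Φ) (hL : Measurable L) (hℓ : Measurable ℓ) (T : ℝ≥0) :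
    meanIntensity P v T (picardStep m Φ L v ℓ)
      ≤ ∫⁻ u in Set.Ioc v T, m u ∂lebesgue + (∫⁻ u, Φ u ∂lebesgue) * meanIntensity P v T ℓ := by
  set e : ℝ≥0 → ℝ≥0∞ := fun u => ∫⁻ ω, ℓ (PredSpace.mk u ω) ∂P with he_def
  have he : Measurable e := (hℓ.comp PredSpace.measurable_swap_mk).lintegral_prod_right'
  have hk : Measurable fun x : ℝ≥0 × ℝ≥0 =>
      (Set.Iio x.1).indicator (fun u => (Φ (x.1 - u) : ℝ≥0∞)) x.2 :=
    ((hΦ.comp (measurable_fst.sub measurable_snd)).coe_nnreal_ennreal).indicator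
      (measurableSet_lt measurable_snd measurable_fst)
  have hstep : ∀ s, ∫⁻ ω, picardStep m Φ L v ℓ (PredSpace.mk s ω) ∂P = m s +
      ∫⁻ u in Set.Ioi v, (Set.Iio s).indicator (fun u => (Φ (s - u) : ℝ≥0∞)) u * e u
        ∂lebesgue := by
    intro s
    rw [hP.lintegral_picardStep hΦ hL hℓ, lintegral_lintegral_swap]
    · congr 1
      refine lintegral_congr fun u => ?_
      exact lintegral_const_mul _ (measurable_pred_config_section hℓ u)
    · exact (((hk.comp (measurable_const.prodMk measurable_id)).comp measurable_snd).mul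
        (hℓ.comp (PredSpace.measurable_swap_mk.comp measurable_swap))).aemeasurable
  rw [meanIntensity_swap (measurable_picardStep hm hΦ hL hℓ), meanIntensity_swap hℓ]
  simp_rw [hstep]
  rw [lintegral_add_left hm.coe_nnreal_ennreal]
  refine add_le_add le_rfl ?_
  rw [lintegral_lintegral_swap]
  · have h2 : ∀ u, ∫⁻ s in Set.Ioc v T,
        (Set.Iio s).indicator (fun u => (Φ (s - u) : ℝ≥0∞)) u * e u ∂lebesgue
          ≤ (Set.Iic T).indicator (fun u => (∫⁻ r, Φ r ∂lebesgue) * e u) u := by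
      intro u
      by_cases hu : u ≤ T
      · have hk' : Measurable fun s => (Set.Iio s).indicator (fun u => (Φ (s - u) : ℝ≥0∞)) u :=
          hk.comp (measurable_id.prodMk measurable_const)
        rw [Set.indicator_of_mem (show u ∈ Set.Iic T from hu), lintegral_mul_const _ hk']
        refine mul_le_mul_left ?_ _
        refine (setLIntegral_le_lintegral _ _).trans ?_
        rw [← lintegral_lebesgue_shift (fun r => (Φ r : ℝ≥0∞)) u,
          ← lintegral_indicator measurableSet_Ioi]
        refine lintegral_mono fun s => le_of_eq ?_
        by_cases hs : u < s
        · rw [Set.indicator_of_mem (show u ∈ Set.Iio s from hs),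
            Set.indicator_of_mem (show s ∈ Set.Ioi u from hs)]
        · rw [Set.indicator_of_notMem (show u ∉ Set.Iio s from hs),
            Set.indicator_of_notMem (show s ∉ Set.Ioi u from hs)]
      · rw [Set.indicator_of_notMem (show u ∉ Set.Iic T from hu), nonpos_iff_eq_zero,
          setLIntegral_congr_fun (g := fun _ => 0) measurableSet_Ioc, lintegral_zero]
        intro s hs
        have : u ∉ Set.Iio s := fun h => hu ((le_of_lt h).trans hs.2)
        simp only [Set.indicator_of_notMem this, zero_mul]
    refine (lintegral_mono h2).trans ?_
    rw [lintegral_indicator measurableSet_Iic, Measure.restrict_restrict measurableSet_Iic,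
      Set.inter_comm, Set.Ioi_inter_Iic, lintegral_const_mul _ he]
  · exact (hk.mul (he.comp measurable_snd)).aemeasurable

theorem IsPoissonRandomMeasure.meanIntensity_picardLimit_lt_top
    (hP : IsPoissonRandomMeasure P (intensityMeasure ν)) (hm : Measurable m)
    (hΦ : IsHawkesKernel Φ) (hL : Measurable L) {T : ℝ≥0}
    (hmT : ∫⁻ u in Set.Ioc v T, m u ∂lebesgue < ∞) :
    meanIntensity P v T (picardLimit m Φ L v) < ∞ := by
  set ρ := ∫⁻ u, Φ u ∂lebesgue with hρ
  set M := ∫⁻ u in Set.Ioc v T, m u ∂lebesgue with hM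
  have hρ1 : ρ < 1 := hΦ.norm_lt_one
  have h0 : 1 - ρ ≠ 0 := (tsub_pos_of_lt hρ1).ne'
  have h1 : 1 - ρ ≠ ∞ := (tsub_le_self.trans_lt ENNReal.one_lt_top).ne
  -- `M / (1 - ρ)` is the fixed point of `x ↦ M + ρ x`.
  have hK : M + ρ * (M * (1 - ρ)⁻¹) = M * (1 - ρ)⁻¹ := by
    calc M + ρ * (M * (1 - ρ)⁻¹) = M * ((1 - ρ) * (1 - ρ)⁻¹) + ρ * (M * (1 - ρ)⁻¹) := by
          rw [ENNReal.mul_inv_cancel h0 h1, mul_one]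
      _ = M * (((1 - ρ) + ρ) * (1 - ρ)⁻¹) := by ring
      _ = M * (1 - ρ)⁻¹ := by rw [tsub_add_cancel_of_le hρ1.le, one_mul]
  have hn : ∀ n, meanIntensity P v T (picard m Φ L v n) ≤ M * (1 - ρ)⁻¹ := by
    intro n
    induction n with
    | zero => simp [meanIntensity, picard]
    | succ n ih =>
      refine (hP.meanIntensity_picardStep_le hm hΦ.measurable hL
        (measurable_picard hm hΦ.measurable hL n) T).trans ?_
      rw [← hK]
      exact add_le_add le_rfl (mul_le_mul_right ih _)
  have hlim : meanIntensity P v T (picardLimit m Φ L v)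
      = ⨆ n, meanIntensity P v T (picard m Φ L v n) := by
    simp only [meanIntensity, picardLimit]
    rw [← lintegral_iSup]
    · refine lintegral_congr fun ω => ?_
      rw [lintegral_iSup]
      · exact fun n => measurable_pred_time_section (measurable_picard hm hΦ.measurable hL n) ω
      · exact fun i j hij u => picard_mono hij _
    · intro n
      exact ((measurable_picard hm hΦ.measurable hL n).comp
        (PredSpace.measurable_swap_mk.comp measurable_swap)).lintegral_prod_right'
    · exact fun i j hij ω => lintegral_mono fun u => picard_mono hij _
  rw [hlim]
  exact (iSup_le hn).trans_lt (ENNReal.mul_lt_top hmT (ENNReal.inv_lt_top.2 h0.bot_lt))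

/-- The number of atoms that are kept by the limit of the Picard iteration in `(s, u]`. -/
def keptCount (m Φ : ℝ≥0 → ℝ≥0) (L : PredSpace → ℝ≥0) (v s u : ℝ≥0) (ω : Config) : ℝ≥0∞ :=
  ω.1 {z | s < z.1 ∧ z.1 ≤ u ∧
    (PredSpace.mk z.1 ω, z.2) ∈ region L v (picardLimit m Φ L v)}

theorem measurableSet_keptCount (hm : Measurable m) (hΦ : Measurable Φ) (hL : Measurable L)
    (s u : ℝ≥0) (ω : Config) : MeasurableSet {z : Mark | s < z.1 ∧ z.1 ≤ u ∧
      (PredSpace.mk z.1 ω, z.2) ∈ region L v (picardLimit m Φ L v)} := by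
  have h : MeasurableSet {z : Mark |
      (PredSpace.mk z.1 ω, z.2) ∈ region L v (picardLimit m Φ L v)} :=
    (measurable_predPoint.comp measurable_prodMk_left)
      (measurableSet_region hL (measurable_picardLimit hm hΦ hL))
  exact (measurable_fst measurableSet_Ioi).inter ((measurable_fst measurableSet_Iic).inter h)

theorem keptCount_eq_lintegral (hm : Measurable m) (hΦ : Measurable Φ) (hL : Measurable L)
    (s u : ℝ≥0) (ω : Config) : keptCount m Φ L v s u ω
      = ∫⁻ z, (region L v (picardLimit m Φ L v)).indicator
        (fun x => {p : PredSpace | s < p.time ∧ p.time ≤ u}.indicator 1 x.1)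
        (PredSpace.mk z.1 ω, z.2) ∂ω.1 := by
  rw [keptCount, ← lintegral_indicator_one (measurableSet_keptCount hm hΦ hL s u ω)]
  refine lintegral_congr fun z => ?_
  classical
  simp only [Set.indicator_apply, Set.mem_ofPred_eq, PredSpace.time_mk, Pi.one_apply]
  by_cases h1 : (PredSpace.mk z.1 ω, z.2) ∈ region L v (picardLimit m Φ L v) <;>
    by_cases h2 : s < z.1 ∧ z.1 ≤ u <;>
    simp only [h1, h2, and_true, and_false, and_self, if_true, if_false]

theorem measurable_keptCount (hm : Measurable m) (hΦ : Measurable Φ) (hL : Measurable L)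
    (s u : ℝ≥0) : Measurable (keptCount m Φ L v s u) := by
  have hS : MeasurableSet {p : PredSpace | s < p.time ∧ p.time ≤ u} :=
    PredSpace.measurable_time measurableSet_Ioc
  have hF : Measurable ((region L v (picardLimit m Φ L v)).indicator
      fun x : PredSpace × (ℝ≥0 × ℝ) =>
        {p : PredSpace | s < p.time ∧ p.time ≤ u}.indicator (1 : PredSpace → ℝ≥0∞) x.1) :=
    ((measurable_one.indicator hS).comp measurable_fst).indicator
      (measurableSet_region hL (measurable_picardLimit hm hΦ hL))
  have := (hF.comp measurable_predPoint).lintegral_kernel_prod_right' (κ := configKernel)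
  convert this using 2 with ω
  exact keptCount_eq_lintegral hm hΦ hL s u ω

/-- On an event of the past, the mean number of kept atoms is the mean integrated intensity. -/
theorem IsPoissonRandomMeasure.setLIntegral_keptCount
    (hP : IsPoissonRandomMeasure P (intensityMeasure ν)) (hm : Measurable m) (hΦ : Measurable Φ)
    (hL : Measurable L) {s u : ℝ≥0} (hvs : v ≤ s) {A : Set Config}
    (hA : MeasurableSet[history s] A) :
    ∫⁻ ω in A, keptCount m Φ L v s u ω ∂P = ∫⁻ ω in A, ∫⁻ r in Set.Ioc s u,
      picardLimit m Φ L v (PredSpace.mk r ω) ∂lebesgue ∂P := by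
  have hA' : MeasurableSet A := history.le s _ hA
  set S : Set PredSpace := {p | (s < p.time ∧ p.config ∈ A) ∧ p.time ≤ u} with hSdef
  have hS : MeasurableSet S :=
    (PredSpace.measurableSet_lt hA).inter (PredSpace.measurable_time measurableSet_Iic)
  have h := hP.lintegral_region (v := v) hL (measurable_picardLimit (v := v) hm hΦ hL)
    ((measurable_one (α := ℝ≥0∞)).indicator hS)
  have hmem : ∀ (r : ℝ≥0) (ω : Config), PredSpace.mk r ω ∈ S ↔ (r ∈ Set.Ioc s u ∧ ω ∈ A) := by
    intro r ω
    simp only [hSdef, Set.mem_ofPred_eq, PredSpace.time_mk, PredSpace.config_mk, Set.mem_Ioc]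
    tauto
  rw [← lintegral_indicator hA', ← lintegral_indicator hA']
  classical
  have h1 : ∀ ω, A.indicator (fun ω => keptCount m Φ L v s u ω) ω
      = ∫⁻ z, (region L v (picardLimit m Φ L v)).indicator (fun x => S.indicator 1 x.1)
        (PredSpace.mk z.1 ω, z.2) ∂ω.1 := by
    intro ω
    by_cases hω : ω ∈ A
    · rw [Set.indicator_of_mem hω, keptCount_eq_lintegral hm hΦ hL]
      refine lintegral_congr fun z => ?_
      simp only [Set.indicator_apply, hmem, hω, and_true]
      rfl
    · rw [Set.indicator_of_notMem hω]
      symm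
      refine (lintegral_congr fun z => ?_).trans lintegral_zero
      simp only [Set.indicator_apply, hmem, hω, and_false, if_false, ite_self]
  have h2 : ∀ ω, A.indicator (fun ω => ∫⁻ r in Set.Ioc s u,
      picardLimit m Φ L v (PredSpace.mk r ω) ∂lebesgue) ω = ∫⁻ r in Set.Ioi v,
        S.indicator 1 (PredSpace.mk r ω) * picardLimit m Φ L v (PredSpace.mk r ω) ∂lebesgue := by
    intro ω
    rw [← lintegral_indicator measurableSet_Ioi]
    by_cases hω : ω ∈ A
    · rw [Set.indicator_of_mem hω, ← lintegral_indicator measurableSet_Ioc]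
      refine lintegral_congr fun r => ?_
      simp only [Set.indicator_apply, hmem, hω, and_true]
      by_cases hr : r ∈ Set.Ioc s u
      · have hrv : r ∈ Set.Ioi v := hvs.trans_lt hr.1
        simp only [hr, hrv, if_true, Pi.one_apply, one_mul]
      · simp only [hr, if_false, zero_mul, ite_self]
    · rw [Set.indicator_of_notMem hω]
      symm
      refine (lintegral_congr fun r => ?_).trans lintegral_zero
      simp only [Set.indicator_apply, hmem, hω, and_false, if_false, zero_mul, ite_self]
  rw [lintegral_congr h1, lintegral_congr h2, h]

end Moments

/-! ### Existence, and the intensity of the counting process -/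

section Existence

variable {ν : Measure ℝ} [IsProbabilityMeasure ν] {P : Measure Config} [IsProbabilityMeasure P]
  {m Φ : ℝ≥0 → ℝ≥0} {L : PredSpace → ℝ≥0} {v : ℝ≥0}

theorem IsPoissonRandomMeasure.lintegral_keptCount_lt_top
    (hP : IsPoissonRandomMeasure P (intensityMeasure ν)) (hm : Measurable m)
    (hΦ : IsHawkesKernel Φ) (hL : Measurable L)
    (hmT : ∀ T, ∫⁻ u in Set.Ioc v T, m u ∂lebesgue < ∞) {s u : ℝ≥0} (hvs : v ≤ s) :
    ∫⁻ ω, keptCount m Φ L v s u ω ∂P < ∞ := by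
  have h := hP.setLIntegral_keptCount (u := u) hm hΦ.measurable hL hvs
    (show MeasurableSet[history s] (Set.univ : Set Config) from MeasurableSet.univ)
  rw [setLIntegral_univ, setLIntegral_univ] at h
  rw [h]
  refine (lintegral_mono fun ω => ?_).trans_lt
    (hP.meanIntensity_picardLimit_lt_top hm hΦ hL (hmT u))
  exact lintegral_mono_set (Set.Ioc_subset_Ioc_left hvs)

/-- Almost surely the limit of the Picard iteration is finite and solves the thinning equation. -/
theorem IsPoissonRandomMeasure.ae_solvesThinning
    (hP : IsPoissonRandomMeasure P (intensityMeasure ν)) (hm : Measurable m)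
    (hΦ : IsHawkesKernel Φ) (hL : Measurable L)
    (hmT : ∀ T, ∫⁻ u in Set.Ioc v T, m u ∂lebesgue < ∞) :
    ∀ᵐ ω ∂P, (∀ u, keptCount m Φ L v v u ω < ∞) ∧
      (∀ s, picardLimit m Φ L v (PredSpace.mk s ω) < ∞) ∧
      SolvesThinning (fun s => m s) Φ (fun s => L (PredSpace.mk s ω)) v ω
        (fun s => picardSum m Φ L v id s ω) (fun s => picardSum m Φ L v (fun _ => 1) s ω)
        (fun s => (picardLimit m Φ L v (PredSpace.mk s ω)).toReal) := by
  have h1 : ∀ n : ℕ, ∀ᵐ ω ∂P, keptCount m Φ L v v n ω < ∞ := fun n =>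
    ae_lt_top (measurable_keptCount hm hΦ.measurable hL v n)
      (hP.lintegral_keptCount_lt_top hm hΦ hL hmT le_rfl).ne
  filter_upwards [ae_all_iff.2 h1, hP.ae_ne_predictable (hL.coe_nnreal_ennreal.add
    (measurable_picardLimit (v := v) hm hΦ.measurable hL))] with ω hω hne
  have hfin : ∀ u, keptCount m Φ L v v u ω < ∞ := by
    intro u
    obtain ⟨n, hn⟩ := exists_nat_ge u
    refine lt_of_le_of_lt (measure_mono ?_) (hω n)
    exact fun z hz => ⟨hz.1, hz.2.1.trans hn, hz.2.2⟩
  refine ⟨hfin, solvesThinning_picard hm hΦ.measurable hL (fun T => ?_) hne⟩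
  refine lt_of_le_of_lt (measure_mono ?_) (hfin T)
  exact fun z hz => ⟨hz.2.1, hz.1, hz.2⟩

theorem picardSum_one_eq (hm : Measurable m) (hΦ : Measurable Φ) (hL : Measurable L) (s : ℝ≥0)
    (ω : Config) : picardSum m Φ L v (fun _ => 1) s ω = (keptCount m Φ L v v s ω).toReal := by
  rw [keptCount, ← measureReal_def,
    ← integral_indicator_one (measurableSet_keptCount hm hΦ hL v s ω), picardSum,
    ← integral_indicator (measurableSet_time_le s)]
  refine integral_congr_ae (Filter.Eventually.of_forall fun z => ?_)
  have h : (v < z.1 ∧ z.1 ≤ s ∧ (PredSpace.mk z.1 ω, z.2) ∈ region L v (picardLimit m Φ L v)) ↔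
      z.1 ≤ s ∧ (PredSpace.mk z.1 ω, z.2) ∈ region L v (picardLimit m Φ L v) :=
    ⟨fun h => h.2, fun h => ⟨h.2.1, h⟩⟩
  classical
  simp only [Set.indicator_apply, Set.mem_ofPred_eq, h, Pi.one_apply]
  by_cases h1 : z.1 ≤ s <;>
    by_cases h2 : (PredSpace.mk z.1 ω, z.2) ∈ region L v (picardLimit m Φ L v) <;>
    simp only [h1, h2, and_true, and_false, if_true, if_false]

theorem picardSum_one_sub (hm : Measurable m) (hΦ : Measurable Φ) (hL : Measurable L)
    {s u : ℝ≥0} (hvs : v ≤ s) (hsu : s ≤ u) {ω : Config}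
    (hfin : ∀ u, keptCount m Φ L v v u ω < ∞) :
    picardSum m Φ L v (fun _ => 1) u ω - picardSum m Φ L v (fun _ => 1) s ω
      = (keptCount m Φ L v s u ω).toReal := by
  have hadd : keptCount m Φ L v v u ω
      = keptCount m Φ L v v s ω + keptCount m Φ L v s u ω := by
    rw [keptCount, keptCount, keptCount,
      ← measure_union _ (measurableSet_keptCount hm hΦ hL s u ω)]
    · congr 1
      ext z
      constructor
      · intro hz
        rcases le_or_gt z.1 s with h | h
        exacts [Or.inl ⟨hz.1, h, hz.2.2⟩, Or.inr ⟨h, hz.2⟩]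
      · rintro (hz | hz)
        exacts [⟨hz.1, hz.2.1.trans hsu, hz.2.2⟩, ⟨hvs.trans_lt hz.1, hz.2⟩]
    · exact Set.disjoint_left.2 fun z hz hz' => absurd hz.2.1 (not_le.2 hz'.1)
  have h1 : keptCount m Φ L v s u ω ≠ ∞ :=
    (lt_of_le_of_lt (hadd ▸ le_add_self) (hfin u)).ne
  rw [picardSum_one_eq hm hΦ hL, picardSum_one_eq hm hΦ hL, hadd,
    ENNReal.toReal_add (hfin s).ne h1, add_sub_cancel_left]

theorem setIntegral_picardLimit_eq (hm : Measurable m) (hΦ : Measurable Φ) (hL : Measurable L)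
    (s u : ℝ≥0) {ω : Config} (hfin : ∀ r, picardLimit m Φ L v (PredSpace.mk r ω) < ∞) :
    ∫ r in Set.Ioc s u, (picardLimit m Φ L v (PredSpace.mk r ω)).toReal ∂lebesgue
      = (∫⁻ r in Set.Ioc s u, picardLimit m Φ L v (PredSpace.mk r ω) ∂lebesgue).toReal :=
  integral_toReal
    (measurable_pred_time_section (measurable_picardLimit hm hΦ hL) ω).aemeasurable
    (Filter.Eventually.of_forall hfin)

theorem condExp_ae_eq_of_setIntegral_eq {Ω : Type*} {m m₀ : MeasurableSpace Ω} {Q : Measure Ω}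
    [IsFiniteMeasure Q] (hm : m ≤ m₀) {f g : Ω → ℝ} (hf : Integrable f Q) (hg : Integrable g Q)
    (h : ∀ G, MeasurableSet[m] G → ∫ ω in G, f ω ∂Q = ∫ ω in G, g ω ∂Q) :
    Q[f|m] =ᵐ[Q] Q[g|m] := by
  refine ae_eq_condExp_of_forall_setIntegral_eq hm hg
    (fun _ _ _ => integrable_condExp.integrableOn) (fun G hG _ => ?_)
    stronglyMeasurable_condExp.aestronglyMeasurable
  rw [setIntegral_condExp hm hf hG, h G hG]

/-- The counting process of the limit of the Picard iteration is a generalized Hawkes process. -/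
theorem IsPoissonRandomMeasure.isGeneralizedHawkes_picard
    (hP : IsPoissonRandomMeasure P (intensityMeasure ν)) (hm : Measurable m)
    (hΦ : IsHawkesKernel Φ) (hL : Measurable L)
    (hmT : ∀ T, ∫⁻ u in Set.Ioc v T, m u ∂lebesgue < ∞) :
    IsGeneralizedHawkes P v (fun s _ => m s) (fun _ => 0) Φ (picardSum m Φ L v fun _ => 1)
      (fun s ω => (picardLimit m Φ L v (PredSpace.mk s ω)).toReal) := by
  have hΛ : Measurable (picardLimit m Φ L v) := measurable_picardLimit hm hΦ.measurable hL
  have hae := hP.ae_solvesThinning hm hΦ hL hmT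
  have hK : ∀ s u, Measurable fun ω =>
      ∫⁻ r in Set.Ioc s u, picardLimit m Φ L v (PredSpace.mk r ω) ∂lebesgue := fun s u =>
    (hΛ.comp (PredSpace.measurable_swap_mk.comp measurable_swap)).lintegral_prod_right'
  have hNK : ∀ s u, v ≤ s → ∀ A, MeasurableSet[history s] A →
      ∫⁻ ω in A, keptCount m Φ L v s u ω ∂P = ∫⁻ ω in A, ∫⁻ r in Set.Ioc s u,
        picardLimit m Φ L v (PredSpace.mk r ω) ∂lebesgue ∂P := fun s u hvs A hA =>
    hP.setLIntegral_keptCount hm hΦ.measurable hL hvs hA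
  have hNfin : ∀ s u, v ≤ s → ∫⁻ ω, keptCount m Φ L v s u ω ∂P < ∞ := fun s u hvs =>
    hP.lintegral_keptCount_lt_top hm hΦ hL hmT hvs
  have hKfin : ∀ s u, v ≤ s → ∫⁻ ω, ∫⁻ r in Set.Ioc s u,
      picardLimit m Φ L v (PredSpace.mk r ω) ∂lebesgue ∂P < ∞ := by
    intro s u hvs
    have h := hNK s u hvs (Set.univ : Set Config) MeasurableSet.univ
    rw [setLIntegral_univ, setLIntegral_univ] at h
    exact h ▸ hNfin s u hvs
  have hN : ∀ s u, Measurable (keptCount m Φ L v s u) := measurable_keptCount hm hΦ.measurable hL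
  have hHae : ∀ s u, v ≤ s → s ≤ u → (fun ω => (keptCount m Φ L v s u ω).toReal) =ᵐ[P]
      fun ω => picardSum m Φ L v (fun _ => 1) u ω - picardSum m Φ L v (fun _ => 1) s ω := by
    intro s u hvs hsu
    filter_upwards [hae] with ω hω
    exact (picardSum_one_sub hm hΦ.measurable hL hvs hsu hω.1).symm
  have hlamae : ∀ s u, (fun ω => (∫⁻ r in Set.Ioc s u,
      picardLimit m Φ L v (PredSpace.mk r ω) ∂lebesgue).toReal) =ᵐ[P] fun ω =>
        ∫ r in Set.Ioc s u, (picardLimit m Φ L v (PredSpace.mk r ω)).toReal ∂lebesgue := by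
    intro s u
    filter_upwards [hae] with ω hω
    exact (setIntegral_picardLimit_eq hm hΦ.measurable hL s u hω.2.1).symm
  have hHint : ∀ s u, v ≤ s → s ≤ u → Integrable (fun ω => picardSum m Φ L v (fun _ => 1) u ω
      - picardSum m Φ L v (fun _ => 1) s ω) P := fun s u hvs hsu =>
    (integrable_toReal_of_lintegral_ne_top (hN s u).aemeasurable (hNfin s u hvs).ne).congr
      (hHae s u hvs hsu)
  have hlamint : ∀ s u, v ≤ s → s ≤ u → Integrable (fun ω => ∫ r in Set.Ioc s u,
      (picardLimit m Φ L v (PredSpace.mk r ω)).toReal ∂lebesgue) P := fun s u hvs _ =>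
    (integrable_toReal_of_lintegral_ne_top (hK s u).aemeasurable (hKfin s u hvs).ne).congr
      (hlamae s u)
  refine ⟨hΦ, measurable_const, fun _ _ => measurable_const, fun _ _ _ => NNReal.coe_nonneg _,
    fun s _ => measurable_picardSum hm hΦ.measurable hL measurable_const s, ?_, ?_, ?_, ?_, ?_,
    hHint, hlamint, fun s u hvs hsu A hA => ?_⟩
  · filter_upwards [hae, hP.ae_simple] with ω hω hsimple
    exact hω.2.2.isCountingPath hsimple
  · filter_upwards [hae] with ω hω
    rw [hω.2.2.H_eq v le_rfl]
    have : kept v (fun s => L (PredSpace.mk s ω)) (fun s =>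
        (picardLimit m Φ L v (PredSpace.mk s ω)).toReal) ω ∩ {z | z.1 ≤ v} = ∅ :=
      Set.eq_empty_of_forall_notMem fun z hz => absurd hz.1.2.1 (not_lt.2 hz.2)
    rw [this, finsum_mem_empty, Nat.cast_zero]
  · filter_upwards [hae] with ω hω s hs
    rw [hω.2.2.lam_eq s hs, kept_jumpIntegral hω.2.2.finite hω.2.2.H_eq]
  · -- At the initial time the intensity is the deterministic base intensity.
    have h : (fun ω => (picardLimit m Φ L v (PredSpace.mk v ω)).toReal) = fun _ => (m v : ℝ) := by
      ext ω
      rw [picardLimit_eq hm hΦ.measurable hL, picardStep, PredSpace.time_mk, PredSpace.config_mk,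
        setLIntegral_congr_fun (g := fun _ => 0) (measurableSet_time_lt v), lintegral_zero,
        add_zero, ENNReal.coe_toReal]
      intro z hz
      exact Set.indicator_of_notMem (fun h => absurd h.1 (not_lt.2 (le_of_lt hz))) _
    rw [h]
    exact measurable_const
  · have h : Measurable fun p : PredSpace =>
        if v < p.time then (picardLimit m Φ L v p).toReal else 0 :=
      Measurable.ite (PredSpace.measurable_time measurableSet_Ioi) hΛ.ennreal_toReal
        measurable_const
    exact h.stronglyMeasurable
  · have hA' : MeasurableSet A := history.le s _ hA
    have hmulN : (fun ω => A.indicator 1 ω * (picardSum m Φ L v (fun _ => 1) u ω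
        - picardSum m Φ L v (fun _ => 1) s ω)) = A.indicator fun ω =>
          picardSum m Φ L v (fun _ => 1) u ω - picardSum m Φ L v (fun _ => 1) s ω := by
      ext ω
      by_cases hω : ω ∈ A <;> simp [hω]
    have hmulK : (fun ω => ∫ r in Set.Ioc s u, A.indicator 1 ω *
        (picardLimit m Φ L v (PredSpace.mk r ω)).toReal ∂lebesgue) = A.indicator fun ω =>
          ∫ r in Set.Ioc s u, (picardLimit m Φ L v (PredSpace.mk r ω)).toReal ∂lebesgue := by
      ext ω
      rw [integral_const_mul]
      by_cases hω : ω ∈ A <;> simp [hω]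
    rw [hmulN, hmulK]
    refine condExp_ae_eq_of_setIntegral_eq (history.le v) ((hHint s u hvs hsu).indicator hA')
      ((hlamint s u hvs hsu).indicator hA') fun G hG => ?_
    have hGA : MeasurableSet[history s] (G ∩ A) := (history.mono hvs _ hG).inter hA
    rw [setIntegral_indicator hA', setIntegral_indicator hA',
      setIntegral_congr_ae₀ (g := fun ω => (keptCount m Φ L v s u ω).toReal)
        (history.le s _ hGA).nullMeasurableSet
        ((hHae s u hvs hsu).mono fun ω hω _ => hω.symm),
      setIntegral_congr_ae₀ (g := fun ω => (∫⁻ r in Set.Ioc s u,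
        picardLimit m Φ L v (PredSpace.mk r ω) ∂lebesgue).toReal)
        (history.le s _ hGA).nullMeasurableSet ((hlamae s u).mono fun ω hω _ => hω.symm),
      integral_toReal (hN s u).aemeasurable (ae_restrict_of_ae
        (ae_lt_top (hN s u) (hNfin s u hvs).ne)),
      integral_toReal (hK s u).aemeasurable (ae_restrict_of_ae
        (ae_lt_top (hK s u) (hKfin s u hvs).ne)), hNK s u hvs _ hGA]

end Existence

/-! ### The compound Hawkes process and its Malliavin derivative -/

section Hawkes

variable {μ : ℝ} {Φ : ℝ≥0 → ℝ≥0} {ω : Config} {X H lam : ℝ≥0 → ℝ}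

theorem SolvesHawkes.eq_solution (h : SolvesHawkes μ Φ ω X H lam) (s : ℝ≥0) :
    X s = compound μ Φ s ω ∧ H s = hawkes μ Φ s ω ∧ lam s = intensity μ Φ s ω := by
  have hex : ∃ p : (ℝ≥0 → ℝ) × (ℝ≥0 → ℝ) × (ℝ≥0 → ℝ), SolvesHawkes μ Φ ω p.1 p.2.1 p.2.2 :=
    ⟨(X, H, lam), h⟩
  have hsol : hawkesSolution μ Φ ω = hex.choose := dif_pos hex
  rw [compound, hawkes, intensity, hsol]
  exact (solvesHawkes_iff.1 h).unique (solvesHawkes_iff.1 hex.choose_spec) zero_le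

theorem SolvesHawkes.solution (h : SolvesHawkes μ Φ ω X H lam) :
    SolvesHawkes μ Φ ω (fun s => compound μ Φ s ω) (fun s => hawkes μ Φ s ω)
      (fun s => intensity μ Φ s ω) := by
  have h1 : X = fun s => compound μ Φ s ω := funext fun s => (h.eq_solution s).1
  have h2 : H = fun s => hawkes μ Φ s ω := funext fun s => (h.eq_solution s).2.1
  have h3 : lam = fun s => intensity μ Φ s ω := funext fun s => (h.eq_solution s).2.2
  rw [← h1, ← h2, ← h3]
  exact h

theorem hawkesDeriv_eq {t θ : ℝ≥0} {x : ℝ} {hX hH hlam : ℝ≥0 → ℝ} (ht : 0 < t)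
    (h : SolvesHawkes μ Φ ω (fun s => compound μ Φ s ω) (fun s => hawkes μ Φ s ω)
      (fun s => intensity μ Φ s ω))
    (h' : SolvesShifted Φ (fun s => intensity μ Φ s ω) t ω hX hH hlam)
    (hatoms : ∀ z ∈ atoms ω, z.1 ≠ t)
    (hne : ∀ z ∈ atoms ω, 0 < z.1 → intensity μ Φ z.1 ω ≠ z.2.1)
    (hθ : (θ : ℝ) ≤ intensity μ Φ t ω) (s : ℝ≥0) :
    (t ≤ s → hawkesDeriv μ Φ t θ x (compound μ Φ s) ω = x + hX s ∧
      hawkesDeriv μ Φ t θ x (hawkes μ Φ s) ω = 1 + hH s ∧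
      hawkesDeriv μ Φ t θ x (intensity μ Φ s) ω = hlam s) ∧
    (s < t → hawkesDeriv μ Φ t θ x (compound μ Φ s) ω = 0 ∧
      hawkesDeriv μ Φ t θ x (hawkes μ Φ s) ω = 0 ∧
      hawkesDeriv μ Φ t θ x (intensity μ Φ s) ω = 0) := by
  have hshift := solvesHawkes_iff.2 (SolvesThinning.shift (x := x) ht (solvesHawkes_iff.1 h)
    (solvesShifted_iff.1 h') hatoms hne hθ)
  obtain ⟨h1, h2, h3⟩ := hshift.eq_solution s
  simp only [hawkesDeriv, if_pos hθ, malliavinDeriv, ← h1, ← h2, ← h3, add_sub_cancel_left]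
  refine ⟨fun hts => ?_, fun hts => ?_⟩
  · simp only [if_pos hts, and_self]
  · simp only [if_neg (not_le.2 hts), and_self]

end Hawkes

/-- The initial intensity `s ↦ 1_{s > t} Φ(s - t)` with values in `ℝ≥0`. -/
def shiftedBaseNN (Φ : ℝ≥0 → ℝ≥0) (t s : ℝ≥0) : ℝ≥0 :=
  (Set.Ioi t).indicator (fun s => Φ (s - t)) s

theorem coe_shiftedBaseNN (Φ : ℝ≥0 → ℝ≥0) (t s : ℝ≥0) :
    (shiftedBaseNN Φ t s : ℝ) = shiftedBase Φ t s := by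
  by_cases h : t < s <;> simp [shiftedBaseNN, shiftedBase, h]

theorem measurable_shiftedBaseNN {Φ : ℝ≥0 → ℝ≥0} (hΦ : Measurable Φ) (t : ℝ≥0) :
    Measurable (shiftedBaseNN Φ t) :=
  (hΦ.comp (measurable_id.sub measurable_const)).indicator measurableSet_Ioi

theorem lintegral_shiftedBaseNN (Φ : ℝ≥0 → ℝ≥0) (t : ℝ≥0) :
    ∫⁻ s in Set.Ioi t, shiftedBaseNN Φ t s ∂lebesgue = ∫⁻ u, Φ u ∂lebesgue := by
  rw [← lintegral_lebesgue_shift (fun u => (Φ u : ℝ≥0∞)) t]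
  refine setLIntegral_congr_fun measurableSet_Ioi fun s hs => ?_
  simp only [shiftedBaseNN, Set.indicator_of_mem hs]

/-- An integrable kernel takes arbitrarily small values, as the half-line has infinite length. -/
theorem IsHawkesKernel.exists_shiftedBase_lt {Φ : ℝ≥0 → ℝ≥0} (hΦ : IsHawkesKernel Φ) (t : ℝ≥0)
    {ε : ℝ} (hε : 0 < ε) : ∃ s, t < s ∧ shiftedBase Φ t s < ε := by
  by_contra! hcon
  have h1 : ∫⁻ s in Set.Ioi t, ENNReal.ofReal ε ∂lebesgue
      ≤ ∫⁻ s in Set.Ioi t, shiftedBaseNN Φ t s ∂lebesgue := by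
    refine setLIntegral_mono (measurable_shiftedBaseNN hΦ.measurable t).coe_nnreal_ennreal
      fun s hs => ?_
    rw [← ENNReal.ofReal_coe_nnreal, coe_shiftedBaseNN]
    exact ENNReal.ofReal_le_ofReal (hcon s hs)
  have h2 : lebesgue (Set.Ioi t) = ∞ := by
    rw [lebesgue_apply measurableSet_Ioi, NNReal.image_coe_Ioi, Real.volume_Ioi]
  rw [lintegral_shiftedBaseNN, setLIntegral_const, h2,
    ENNReal.mul_top (ENNReal.ofReal_pos.2 hε).ne'] at h1
  exact absurd hΦ.norm_lt_one (not_lt.2 (le_top.trans h1))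

end HawkesMalliavin

end

theorem mainTheorem6
    (ν : Measure ℝ) [IsProbabilityMeasure ν] (hν : ν {0} = 0)
    (P : Measure HawkesMalliavin.Config) [IsProbabilityMeasure P]
    (hP : HawkesMalliavin.IsPoissonRandomMeasure P (HawkesMalliavin.intensityMeasure ν))
    (μ : ℝ) (hμ : 0 < μ) (Φ : ℝ≥0 → ℝ≥0) (hΦ : HawkesMalliavin.IsHawkesKernel Φ) (t : ℝ≥0) :
    -- almost surely `(X, H, λ)` is the unique solution of its thinning equation
    (∀ᵐ ω ∂P,
      HawkesMalliavin.SolvesHawkes μ Φ ω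
        (fun s => HawkesMalliavin.compound μ Φ s ω) (fun s => HawkesMalliavin.hawkes μ Φ s ω)
        (fun s => HawkesMalliavin.intensity μ Φ s ω) ∧
      ∀ X H lam : ℝ≥0 → ℝ, HawkesMalliavin.SolvesHawkes μ Φ ω X H lam → ∀ s,
        X s = HawkesMalliavin.compound μ Φ s ω ∧ H s = HawkesMalliavin.hawkes μ Φ s ω ∧
        lam s = HawkesMalliavin.intensity μ Φ s ω) ∧
    ∃ hX hH hlam : ℝ≥0 → HawkesMalliavin.Config → ℝ,
      (∀ s, t ≤ s → Measurable[HawkesMalliavin.history s] (hX s)) ∧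
      -- almost surely `(hX, hH, hlam)` is the unique solution of the shifted equation
      (∀ᵐ ω ∂P,
        HawkesMalliavin.SolvesShifted Φ (fun s => HawkesMalliavin.intensity μ Φ s ω) t ω
          (fun s => hX s ω) (fun s => hH s ω) (fun s => hlam s ω) ∧
        ∀ X H lam : ℝ≥0 → ℝ,
          HawkesMalliavin.SolvesShifted Φ (fun s => HawkesMalliavin.intensity μ Φ s ω) t ω
            X H lam →
          ∀ s, t ≤ s → X s = hX s ω ∧ H s = hH s ω ∧ lam s = hlam s ω) ∧
      -- the Malliavin derivative of `(X_s, H_s, λ_s)`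
      (0 < t → ∀ᵐ ω ∂P, ∀ (θ : ℝ≥0) (x : ℝ),
        (θ : ℝ) ≤ HawkesMalliavin.intensity μ Φ t ω → ∀ s,
          (t ≤ s →
            HawkesMalliavin.hawkesDeriv μ Φ t θ x (HawkesMalliavin.compound μ Φ s) ω
              = x + hX s ω ∧
            HawkesMalliavin.hawkesDeriv μ Φ t θ x (HawkesMalliavin.hawkes μ Φ s) ω
              = 1 + hH s ω ∧
            HawkesMalliavin.hawkesDeriv μ Φ t θ x (HawkesMalliavin.intensity μ Φ s) ω
              = hlam s ω) ∧
          (s < t →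
            HawkesMalliavin.hawkesDeriv μ Φ t θ x (HawkesMalliavin.compound μ Φ s) ω = 0 ∧
            HawkesMalliavin.hawkesDeriv μ Φ t θ x (HawkesMalliavin.hawkes μ Φ s) ω = 0 ∧
            HawkesMalliavin.hawkesDeriv μ Φ t θ x (HawkesMalliavin.intensity μ Φ s) ω = 0)) ∧
      -- `(hH, hlam)` is a generalized Hawkes process on `[t, ∞)`, whose initial intensity is
      -- not bounded away from zero
      HawkesMalliavin.IsGeneralizedHawkes P t (fun s _ => HawkesMalliavin.shiftedBase Φ t s)
        (fun _ => 0) Φ hH hlam ∧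
      (∀ ε : ℝ, 0 < ε → ∃ s, t < s ∧ HawkesMalliavin.shiftedBase Φ t s < ε) := by
  open HawkesMalliavin in
  set Λ := picardLimit (fun _ => μ.toNNReal) Φ 0 0 with hΛdef
  have hΛ : Measurable Λ := measurable_picardLimit measurable_const hΦ.measurable measurable_zero
  -- Outside a null set `Λ` is finite, and `L` is the intensity `λ` of the Hawkes process.
  set L : PredSpace → ℝ≥0 := fun p => (Λ p).toNNReal with hLdef
  have hL : Measurable L := hΛ.ennreal_toNNReal
  have hm := measurable_shiftedBaseNN hΦ.measurable t
  have hbase : ∀ T, ∫⁻ _u in Set.Ioc 0 T, (μ.toNNReal : ℝ≥0∞) ∂lebesgue < ∞ := by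
    intro T
    rw [setLIntegral_const]
    refine ENNReal.mul_lt_top ENNReal.coe_lt_top ?_
    refine (measure_mono (fun u hu => hu.2)).trans_lt ((lebesgue_Iic T).trans_lt ENNReal.coe_lt_top)
  have hbase' : ∀ T, ∫⁻ u in Set.Ioc t T, shiftedBaseNN Φ t u ∂lebesgue < ∞ := fun T =>
    ((lintegral_mono_set Set.Ioc_subset_Ioi_self).trans_eq
      (lintegral_shiftedBaseNN Φ t)).trans_lt (hΦ.norm_lt_one.trans ENNReal.one_lt_top)
  have hbaseEq : (fun s => (shiftedBaseNN Φ t s : ℝ)) = shiftedBase Φ t :=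
    funext fun s => coe_shiftedBaseNN Φ t s
  -- The compound Hawkes equation is the thinning equation above the zero path.
  have hsol : ∀ᵐ ω ∂P, SolvesHawkes μ Φ ω (fun s => compound μ Φ s ω) (fun s => hawkes μ Φ s ω)
      (fun s => intensity μ Φ s ω) ∧ ∀ s, intensity μ Φ s ω = L (PredSpace.mk s ω) := by
    filter_upwards [hP.ae_solvesThinning (v := 0) measurable_const hΦ measurable_zero hbase]
      with ω hω
    have h1 := hω.2.2
    simp only [Real.coe_toNNReal μ hμ.le] at h1
    have h2 := solvesHawkes_iff.2 h1
    exact ⟨h2.solution, fun s => (h2.eq_solution s).2.2.symm⟩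
  have hshift : ∀ᵐ ω ∂P, SolvesShifted Φ (fun s => intensity μ Φ s ω) t ω
      (fun s => picardSum (shiftedBaseNN Φ t) Φ L t id s ω)
      (fun s => picardSum (shiftedBaseNN Φ t) Φ L t (fun _ => 1) s ω)
      (fun s => (picardLimit (shiftedBaseNN Φ t) Φ L t (PredSpace.mk s ω)).toReal) := by
    filter_upwards [hsol, hP.ae_solvesThinning hm hΦ hL hbase'] with ω hω hω'
    have h1 := hω'.2.2
    rw [hbaseEq] at h1
    rw [show (fun s => intensity μ Φ s ω) = fun s => (L (PredSpace.mk s ω) : ℝ) from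
      funext hω.2]
    exact solvesShifted_iff.2 h1
  refine ⟨?_, picardSum (shiftedBaseNN Φ t) Φ L t id,
    picardSum (shiftedBaseNN Φ t) Φ L t (fun _ => 1),
    fun s ω => (picardLimit (shiftedBaseNN Φ t) Φ L t (PredSpace.mk s ω)).toReal,
    fun s _ => measurable_picardSum hm hΦ.measurable hL measurable_id s, ?_, fun ht => ?_, ?_,
    fun ε hε => hΦ.exists_shiftedBase_lt t hε⟩
  · filter_upwards [hsol] with ω hω
    exact ⟨hω.1, fun X H lam h => h.eq_solution⟩
  · filter_upwards [hshift] with ω hω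
    exact ⟨hω, fun X H lam h s hs =>
      (solvesShifted_iff.1 h).unique (solvesShifted_iff.1 hω) hs⟩
  · filter_upwards [hsol, hshift, hP.ae_time_ne t, hP.ae_ne_predictable hL.coe_nnreal_ennreal]
      with ω hω hω' hatoms hne θ x hθ s
    refine hawkesDeriv_eq ht hω.1 hω' hatoms (fun z hz _ h => hne z hz ?_) hθ s
    rw [hω.2] at h
    exact_mod_cast h
  · have h := hP.isGeneralizedHawkes_picard hm hΦ hL hbase'
    simp only [coe_shiftedBaseNN] at h
    exact h
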